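/- All graphs are finite and simple. For $t,\Delta\in\mathbb{N}$, a $(t,\Delta)$-tree is a tree with maximum degree at most $\Delta$ and at most $t$ vertices of degree at least $3$. A graph $G$ is $(t,\Delta)$-tree convex if it is bipartite with some bipartition $(A,B)$ for which there is a $(t,\Delta)$-tree $H$ with $V(H)=A$ such that, for every $b\in B$, the set of neighbours of $b$ is empty or induces a connected subgraph of $H$. A branch decomposition of $G$ is a pair $(T,\delta)$ of a tree $T$ of maximum degree at most $3$ and a bijection $\delta$ from $V(G)$ to the leaves of $T$ (the vertex of a one-vertex tree counts as a leaf). Every edge $e$ of $T$ splits $V(G)$ into two parts $A_e,\overline{A_e}$ according to the components of $T-e$; $\mathrm{mimw}_G(T,\delta)$ is the maximum over all $e$ of the size of a largest induced matching in the bipartite graph formed by the edges of $G$ between $A_e$ and $\overline{A_e}$ (and $0$ if $T$ has no edge), and the mim-width $\mathrm{mimw}(G)$ is the minimum of $\mathrm{mimw}_G(T,\delta)$ over all branch decompositions of $G$. **Theorem.** Let $t,\Delta\in\mathbb{N}$ with $t\ge 1$ and $\Delta\ge 3$, and put $$f(t,\Delta)=\max\left\{2\left\lfloor\left(\tfrac{\Delta}{2}\right)^2\right\rfloor,\,2\Delta-1\right\}+t^2\Delta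 .$$ Then every $(t,\Delta)$-tree convex graph $G$ satisfies $\mathrm{mimw}(G)\le f(t,\Delta)$. Moreover, there is an algorithm (depending on $t$ and $\Delta$) that, given a $(t,\Delta)$-tree convex graph $G$, computes in time polynomial in $|V(G)|$ a branch decomposition $(T,\delta)$ of $G$ with $\mathrm{mimw}_G(T,\delta)\le f(t,\Delta)$. -/

import Mathlib

namespace TreeConvex

noncomputable section

universe u

/-! ### Tree convex graphs -/

/-- The degree of a vertex, with values in `ℕ∞`. -/
def deg {V : Type u} (G : SimpleGraph V) (v : V) : ℕ∞ := (G.neighborSet v).encard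

/-- A `(t, Δ)`-tree: a tree with maximum degree at most `Δ` and at most `t` vertices of degree at
least `3`. -/
structure IsBoundedTree (t Δ : ℕ) {W : Type u} (H : SimpleGraph W) : Prop where
  isTree : H.IsTree
  deg_le : ∀ w, deg H w ≤ Δ
  branching_le : {w | 3 ≤ deg H w}.encard ≤ t

/-- `G` is a `(t, Δ)`-tree convex graph: it is a bipartite graph with parts `A` and `B`, and there
is a `(t, Δ)`-tree `H` with vertex set `A` such that the neighbourhood of every `b ∈ B` induces a
connected subgraph of `H`. (Isolated vertices `b` are allowed: the empty subgraph counts as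
connected here.) -/
def IsTreeConvex (t Δ : ℕ) {V : Type u} (G : SimpleGraph V) : Prop :=
  ∃ A B : Set V, A ∪ B = Set.univ ∧ G.IsBipartiteWith A B ∧
    ∃ H : SimpleGraph A, IsBoundedTree t Δ H ∧
      ∀ b ∈ B, (H.induce {a : A | G.Adj b a}).Preconnected

/-! ### Mim-width -/

/-- `M` is an induced matching of `H`: a set of edges such that different edges share no endpoint
and no edge of `H` joins vertices of different edges of `M`. -/
def IsInducedMatching {V : Type u} (H : SimpleGraph V) (M : Set (Sym2 V)) : Prop :=
  M ⊆ H.edgeSet ∧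
    ∀ e ∈ M, ∀ f ∈ M, e ≠ f → ∀ u ∈ e, ∀ v ∈ f, u ≠ v ∧ ¬ H.Adj u v

/-- The maximum size of an induced matching in the bipartite graph formed by the edges of `G`
between `X` and its complement. -/
def cutMim {V : Type u} (G : SimpleGraph V) (X : Set V) : ℕ∞ :=
  ⨆ (M : Set (Sym2 V)) (_ : IsInducedMatching (G.between X Xᶜ) M), M.encard

/-- A branch decomposition of a graph with vertex set `V`: a finite subcubic tree `T` with a
bijection `δ` from `V` to the leaves of `T`. A leaf is a vertex of degree at most one, so that the
vertex of a one-vertex tree is a leaf. -/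
structure BranchDecomposition (V : Type u) where
  /-- the number of nodes of the tree -/
  m : ℕ
  /-- the tree -/
  T : SimpleGraph (Fin m)
  isTree : T.IsTree
  subcubic : ∀ x, deg T x ≤ 3
  /-- the bijection to the leaves -/
  δ : V ≃ {x : Fin m // deg T x ≤ 1}

/-- For an edge `xy` of the tree, the vertices mapped to the component of `T - xy` that
contains `x`. -/
def BranchDecomposition.side {V : Type u} (D : BranchDecomposition V) (x y : Fin D.m) : Set V :=
  {v | (D.T.deleteEdges {s(x, y)}).Reachable x (D.δ v)}

/-- The mim-width of a branch decomposition of `G`: the maximum, over all tree edges, of the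
value of the induced cut. -/
def BranchDecomposition.mimw {V : Type u} (D : BranchDecomposition V) (G : SimpleGraph V) : ℕ∞ :=
  ⨆ (x : Fin D.m) (y : Fin D.m) (_ : D.T.Adj x y), cutMim G (D.side x y)

/-- The mim-width of `G`: the minimum over all branch decompositions. -/
def mimWidth {V : Type u} (G : SimpleGraph V) : ℕ∞ :=
  ⨅ D : BranchDecomposition V, D.mimw G

/-- `max {2 ⌊(Δ/2)²⌋, 2Δ - 1} + t² Δ`. -/
def mimBound (t Δ : ℕ) : ℕ :=
  max (2 * ⌊((Δ : ℚ) / 2) ^ 2⌋₊) (2 * Δ - 1) + t ^ 2 * Δ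

/-! ### Random access machine programs with a step count

The machine has registers and finitely many arrays (those named in the program), all holding
natural numbers. The arithmetic operations are addition and truncated subtraction only, so that
the bit length of a number grows by at most one in each operation and the unit-cost measure is
polynomially related to the time of Turing machines. -/

/-- A state: the contents of the registers and of the arrays. -/
structure State where
  /-- the contents of the register `x` -/
  reg : ℕ → ℕ
  /-- the contents of cell `i` of the array `a` -/
  arr : ℕ → ℕ → ℕ

/-- Arithmetic expressions. -/
inductive Expr where
  | const (c : ℕ)
  | reg (x : ℕ)
  | read (a : ℕ) (i : Expr)
  | add (e₁ e₂ : Expr)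
  | sub (e₁ e₂ : Expr)

/-- The value of an expression. -/
def Expr.eval (s : State) : Expr → ℕ
  | .const c => c
  | .reg x => s.reg x
  | .read a i => s.arr a (i.eval s)
  | .add e₁ e₂ => e₁.eval s + e₂.eval s
  | .sub e₁ e₂ => e₁.eval s - e₂.eval s

/-- The number of steps needed to evaluate an expression. -/
def Expr.cost : Expr → ℕ
  | .const _ => 1
  | .reg _ => 1
  | .read _ i => i.cost + 1
  | .add e₁ e₂ => e₁.cost + e₂.cost + 1
  | .sub e₁ e₂ => e₁.cost + e₂.cost + 1

/-- Programs. A test `e` succeeds if the value of `e` is not zero. -/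
inductive Prog where
  | skip
  | assign (x : ℕ) (e : Expr)
  | write (a : ℕ) (i e : Expr)
  | seq (p q : Prog)
  | cond (e : Expr) (p q : Prog)
  | loop (e : Expr) (p : Prog)

/-- `Exec p s s' k`: started in the state `s`, the program `p` halts in the state `s'` after
exactly `k` steps. -/
inductive Exec : Prog → State → State → ℕ → Prop where
  | skip (s : State) : Exec .skip s s 1
  | assign (s : State) (x : ℕ) (e : Expr) :
      Exec (.assign x e) s { s with reg := Function.update s.reg x (e.eval s) } (e.cost + 1)
  | write (s : State) (a : ℕ) (i e : Expr) :
      Exec (.write a i e) s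
        { s with
          arr := Function.update s.arr a (Function.update (s.arr a) (i.eval s) (e.eval s)) }
        (i.cost + e.cost + 1)
  | seq {p q : Prog} {s s' s'' : State} {k l : ℕ} :
      Exec p s s' k → Exec q s' s'' l → Exec (.seq p q) s s'' (k + l)
  | cond_true {e : Expr} {p q : Prog} {s s' : State} {k : ℕ} :
      e.eval s ≠ 0 → Exec p s s' k → Exec (.cond e p q) s s' (e.cost + 1 + k)
  | cond_false {e : Expr} {p q : Prog} {s s' : State} {k : ℕ} :
      e.eval s = 0 → Exec q s s' k → Exec (.cond e p q) s s' (e.cost + 1 + k)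
  | loop_true {e : Expr} {p : Prog} {s s' s'' : State} {k l : ℕ} :
      e.eval s ≠ 0 → Exec p s s' k → Exec (.loop e p) s' s'' l →
        Exec (.loop e p) s s'' (e.cost + 1 + k + l)
  | loop_false {e : Expr} {p : Prog} {s : State} :
      e.eval s = 0 → Exec (.loop e p) s s (e.cost + 1)

open Classical in
/-- The input state for a graph `G` on `n` vertices: register `0` holds `n`, array `0` holds the
adjacency matrix of `G` row by row, and everything else is zero. -/
def inputState {n : ℕ} (G : SimpleGraph (Fin n)) : State where
  reg := fun x => if x = 0 then n else 0
  arr := fun a k =>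
    if a = 0 ∧ ∃ i j : Fin n, G.Adj i j ∧ k = (i : ℕ) * n + (j : ℕ) then 1 else 0

/-- The state `s` holds the branch decomposition `D`: register `0` holds the number `m` of nodes of
the tree, array `0` holds the adjacency matrix of the tree row by row (nonzero entries stand for
edges), and cell `v` of array `1` holds the leaf of the vertex `v`. -/
structure Holds {n : ℕ} (s : State) (D : BranchDecomposition (Fin n)) : Prop where
  size : s.reg 0 = D.m
  adj : ∀ x y : Fin D.m, D.T.Adj x y ↔ s.arr 0 ((x : ℕ) * D.m + (y : ℕ)) ≠ 0
  leaf : ∀ v : Fin n, s.arr 1 v = ((D.δ v : Fin D.m) : ℕ)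

/-- One program computes, in polynomial time, for every graph in the class `C` a branch
decomposition of mim-width at most `k`. -/
def ComputableWithin (C : ∀ {n : ℕ}, SimpleGraph (Fin n) → Prop) (k : ℕ) : Prop :=
  ∃ (p : Prog) (time : Polynomial ℕ), ∀ (n : ℕ) (G : SimpleGraph (Fin n)), C G →
    ∃ (s : State) (steps : ℕ) (D : BranchDecomposition (Fin n)),
      Exec p (inputState G) s steps ∧ steps ≤ time.eval n ∧ Holds s D ∧ D.mimw G ≤ k

end

end TreeConvex

/-!
Root the host tree at a vertex `r`. If two vertices of `A` have incomparable neighbourhoods within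
`N(r)`, then neither is an ancestor of the other, since connected neighbourhoods contain tree paths.
In an antichain of such vertices, let each vertex climb to the first vertex on its way to the root
whose parent is the root or has degree at least three. The ends are distinct, and there are at most
`t * Δ + 2` of them. So the cut around a set of vertices in which every edge can be replaced by an
edge from `r` has mim-width at most `t * Δ + 2`.

Merge vertices greedily: a vertex of `A` into a vertex of `A` adjacent to all of its remaining
neighbours, and a vertex outside of `A` into its only remaining neighbour. All cuts of the resulting
binary tree are of the above kind or have all edges at one vertex. The order of the merges is
irrelevant, because each of them preserves whether the remaining part of `A` can be dismantled,
which it can by removing a vertex of the host tree farthest from the root in favour of its parent.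
Neither the bipartition nor the host tree is needed as input: the side of every component is found
by trying both sides, running the merges and computing the antichains by brute force.
-/

namespace TreeConvex

universe u v

/-! ### Dismantlable sets -/

section Dismantling

variable {V : Type u} {G : SimpleGraph V}

/-- The vertex `a` can be removed from `X` in favour of `a'`: every vertex adjacent to `a` and to a
further vertex of `X` is adjacent to `a'`. If `G` is bipartite and `X` is a side, then this is
domination of `a` by `a'` once the vertices with only one neighbour in `X` are ignored. -/
def Reducible (G : SimpleGraph V) (X : Finset V) (a a' : V) : Prop :=
  ∀ b, G.Adj b a → (∃ x ∈ X, x ≠ a ∧ G.Adj b x) → G.Adj b a'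

lemma Reducible.mono {X Y : Finset V} {a a' : V} (h : Reducible G X a a') (hY : Y ⊆ X) :
    Reducible G Y a a' := fun b hb ⟨x, hx, hxa, hbx⟩ => h b hb ⟨x, hY hx, hxa, hbx⟩

/-- A retraction `r` of `X` onto `Y` with a section `s`, both compatible with reductions. The
section need not be an inclusion: this is what makes the notion stable under reductions of `X`. -/
structure IsRetraction (G : SimpleGraph V) (X Y : Finset V) (r s : V → V) : Prop where
  map_mem : ∀ x ∈ X, r x ∈ Y
  section_mem : ∀ y ∈ Y, s y ∈ X
  map_section : ∀ y ∈ Y, r (s y) = y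
  reducible_map : ∀ x ∈ X, Reducible G X x (r x)
  reducible_section_map : ∀ x ∈ X, Reducible G X x (s (r x))
  reducible_section : ∀ y ∈ Y, Reducible G Y y (s y)

namespace IsRetraction

variable {X Y : Finset V} {r s : V → V} {a a' y : V}

lemma section_injOn (h : IsRetraction G X Y r s) : Set.InjOn s Y := fun x hx y hy hxy => by
  rw [← h.map_section x hx, hxy, h.map_section y hy]

lemma section_ne (h : IsRetraction G X Y r s) (hy : y ∈ Y) :
    ∀ z ∈ Y, z ≠ y → s z ≠ s y := fun _ hz hzy => h.section_injOn.ne hz hy hzy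

lemma adj_of_reducible_section (h : IsRetraction G X Y r s) (hred : Reducible G X (s y) a')
    {x b : V} (hx : x ∈ X) (hxy : x ≠ s y) (hrx : r x = y) (hbx : G.Adj b x)
    (hb : ∃ x' ∈ X, x' ≠ x ∧ G.Adj b x') : G.Adj b (s y) ∧ G.Adj b a' := by
  have hby : G.Adj b (s y) := hrx ▸ h.reducible_section_map x hx b hbx hb
  exact ⟨hby, hred b hby ⟨x, hx, hxy, hbx⟩⟩

lemma adj_of_adj_section (h : IsRetraction G X Y r s) (hy : y ∈ Y) (hred : Reducible G X (s y) a')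
    {b : V} (hby : G.Adj b y) (hb : ∃ z ∈ Y, z ≠ y ∧ G.Adj b z) :
    G.Adj b (s y) ∧ G.Adj b a' := by
  obtain ⟨z, hz, hzy, hbz⟩ := hb
  have hbsy := h.reducible_section y hy b hby ⟨z, hz, hzy, hbz⟩
  exact ⟨hbsy, hred b hbsy ⟨s z, h.section_mem z hz, h.section_ne hy z hz hzy,
    h.reducible_section z hz b hbz ⟨y, hy, hzy.symm, hby⟩⟩⟩

lemma reducible (h : IsRetraction G X Y r s) (hy : y ∈ Y) (ha' : a' ∈ X) (hne : s y ≠ a')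
    (hred : Reducible G X (s y) a') : Reducible G Y y (r a') := fun b hby hb =>
  have ⟨hbsy, hba'⟩ := h.adj_of_adj_section hy hred hby hb
  h.reducible_map a' ha' b hba' ⟨s y, h.section_mem y hy, hne, hbsy⟩

variable [DecidableEq V]

lemma erase_of_forall_ne (h : IsRetraction G X Y r s) (ha : ∀ y ∈ Y, s y ≠ a) :
    IsRetraction G (X.erase a) Y r s where
  map_mem x hx := h.map_mem x (Finset.mem_of_mem_erase hx)
  section_mem y hy := Finset.mem_erase.2 ⟨ha y hy, h.section_mem y hy⟩
  map_section := h.map_section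
  reducible_map x hx := (h.reducible_map x (Finset.mem_of_mem_erase hx)).mono
    (Finset.erase_subset _ _)
  reducible_section_map x hx := (h.reducible_section_map x (Finset.mem_of_mem_erase hx)).mono
    (Finset.erase_subset _ _)
  reducible_section := h.reducible_section

lemma update_section (h : IsRetraction G X Y r s) (hy : y ∈ Y) (ha' : a' ∈ X) (hne : s y ≠ a')
    (hred : Reducible G X (s y) a') (hr : r a' = y) :
    IsRetraction G (X.erase (s y)) Y r (Function.update s y a') where
  map_mem x hx := h.map_mem x (Finset.mem_of_mem_erase hx)
  section_mem z hz := by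
    by_cases hzy : z = y
    · simpa [hzy, ha'] using hne.symm
    · simpa [hzy, h.section_mem z hz] using h.section_ne hy z hz hzy
  map_section z hz := by
    by_cases hzy : z = y
    · simp [hzy, hr]
    · simp [hzy, h.map_section z hz]
  reducible_map x hx := (h.reducible_map x (Finset.mem_of_mem_erase hx)).mono
    (Finset.erase_subset _ _)
  reducible_section_map x hx b hbx hb := by
    have hb' := hb.imp fun x' hx' => hx'.imp_left Finset.mem_of_mem_erase
    rw [Finset.mem_erase] at hx
    by_cases hrx : r x = y
    · simpa [hrx] using (h.adj_of_reducible_section hred hx.2 hx.1 hrx hbx hb').2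
    · simpa [hrx] using h.reducible_section_map x hx.2 b hbx hb'
  reducible_section z hz b hbz hb := by
    by_cases hzy : z = y
    · subst hzy
      simpa using (h.adj_of_adj_section hy hred hbz hb).2
    · simpa [hzy] using h.reducible_section z hz b hbz hb

lemma erase (h : IsRetraction G X Y r s) (hy : y ∈ Y) (ha' : a' ∈ X) (hne : s y ≠ a')
    (hred : Reducible G X (s y) a') (hr : r a' ≠ y) :
    IsRetraction G (X.erase (s y)) (Y.erase y) (fun x => if r x = y then r a' else r x) s where
  map_mem x hx := by
    split_ifs with hrx
    · simp [hr, h.map_mem a' ha']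
    · simp [hrx, h.map_mem x (Finset.mem_of_mem_erase hx)]
  section_mem z hz := by
    rw [Finset.mem_erase] at hz ⊢
    exact ⟨h.section_ne hy z hz.2 hz.1, h.section_mem z hz.2⟩
  map_section z hz := by
    rw [Finset.mem_erase] at hz
    simp [h.map_section z hz.2, hz.1]
  reducible_map x hx b hbx hb := by
    have hb' := hb.imp fun x' hx' => hx'.imp_left Finset.mem_of_mem_erase
    rw [Finset.mem_erase] at hx
    split_ifs with hrx
    · obtain ⟨hby, hba'⟩ := h.adj_of_reducible_section hred hx.2 hx.1 hrx hbx hb'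
      exact h.reducible_map a' ha' b hba' ⟨s y, h.section_mem y hy, hne, hby⟩
    · exact h.reducible_map x hx.2 b hbx hb'
  reducible_section_map x hx b hbx hb := by
    have hb' := hb.imp fun x' hx' => hx'.imp_left Finset.mem_of_mem_erase
    rw [Finset.mem_erase] at hx
    split_ifs with hrx
    · obtain ⟨hby, hba'⟩ := h.adj_of_reducible_section hred hx.2 hx.1 hrx hbx hb'
      exact h.reducible_section_map a' ha' b hba' ⟨s y, h.section_mem y hy, hne, hby⟩
    · exact h.reducible_section_map x hx.2 b hbx hb'
  reducible_section z hz := (h.reducible_section z (Finset.mem_of_mem_erase hz)).mono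
    (Finset.erase_subset _ _)

end IsRetraction

variable [DecidableEq V]

/-- The set `X` can be reduced to at most one vertex. -/
inductive Dismantlable (G : SimpleGraph V) : Finset V → Prop
  | base {X : Finset V} : X.card ≤ 1 → Dismantlable G X
  | step {X : Finset V} {a a' : V} : a ∈ X → a' ∈ X → a ≠ a' → Reducible G X a a' →
      Dismantlable G (X.erase a) → Dismantlable G X

lemma Dismantlable.of_isRetraction {X Y : Finset V} {r s : V → V} (hX : Dismantlable G X)
    (h : IsRetraction G X Y r s) : Dismantlable G Y := by
  induction hX generalizing Y r s with
  | base hcard => exact .base ((Finset.card_le_card_of_injOn s h.section_mem h.section_injOn).trans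
      hcard)
  | @step X a a' ha ha' hne hred _ ih =>
    by_cases hs : ∃ y ∈ Y, s y = a
    · obtain ⟨y, hy, rfl⟩ := hs
      by_cases hr : r a' = y
      · exact ih (h.update_section hy ha' hne hred hr)
      · exact .step hy (h.map_mem a' ha') (Ne.symm hr) (h.reducible hy ha' hne hred)
          (ih (h.erase hy ha' hne hred hr))
    · push Not at hs
      exact ih (h.erase_of_forall_ne hs)

lemma isRetraction_erase {X : Finset V} {a a' : V} (ha' : a' ∈ X) (hne : a ≠ a')
    (hred : Reducible G X a a') :
    IsRetraction G X (X.erase a) (fun x => if x = a then a' else x) id := by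
  have reducible_map (x : V) : Reducible G X x (if x = a then a' else x) := by
    split_ifs with hx
    · rwa [hx]
    · exact fun b hb _ => hb
  refine ⟨fun x hx => ?_, fun _ => Finset.mem_of_mem_erase, fun x hx => ?_,
    fun x _ => reducible_map x, fun x _ => reducible_map x, fun _ _ _ hb _ => hb⟩
  · split_ifs with hxa
    · simp [ha', hne.symm]
    · simp [hxa, hx]
  · simp [Finset.ne_of_mem_erase hx]

lemma dismantlable_erase_iff {X : Finset V} {a a' : V} (ha : a ∈ X) (ha' : a' ∈ X) (hne : a ≠ a')
    (hred : Reducible G X a a') : Dismantlable G (X.erase a) ↔ Dismantlable G X :=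
  ⟨.step ha ha' hne hred, fun h => h.of_isRetraction (isRetraction_erase ha' hne hred)⟩

lemma Dismantlable.filter {X : Finset V} (h : Dismantlable G X) (p : V → Prop) [DecidablePred p]
    (hp : ∀ x y, p x → G.Adj x y → p y) : Dismantlable G (X.filter p) := by
  induction h with
  | base h => exact .base ((Finset.card_filter_le _ _).trans h)
  | @step X a a' ha ha' hne hred _ ih =>
    rw [Finset.filter_erase] at ih
    by_cases hpa : p a
    · have hred' := hred.mono (Finset.filter_subset p X)
      by_cases hpa' : p a'
      · exact .step (Finset.mem_filter.2 ⟨ha, hpa⟩) (Finset.mem_filter.2 ⟨ha', hpa'⟩) hne hred' ih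
      · by_cases hcard : (X.filter p).card ≤ 1
        · exact .base hcard
        · obtain ⟨c, hc, hca⟩ := Finset.exists_mem_ne (not_le.1 hcard) a
          refine .step (Finset.mem_filter.2 ⟨ha, hpa⟩) hc (Ne.symm hca) (fun b hb hx => ?_) ih
          exact absurd (hp _ _ (hp _ _ hpa hb.symm) (hred' b hb hx)) hpa'
    · rwa [Finset.erase_eq_of_notMem (by simp [hpa])] at ih

lemma Dismantlable.insert {Y : Finset V} {x : V} (hY : Dismantlable G Y) (hx : x ∉ Y)
    (h : ∀ y ∈ Y, ∀ b, G.Adj b x → ¬ G.Adj b y) : Dismantlable G (insert x Y) := by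
  obtain rfl | ⟨y, hy⟩ := Y.eq_empty_or_nonempty
  · exact .base (by simp)
  refine .step (a := x) (a' := y) (by simp) (by simp [hy]) (by rintro rfl; exact hx hy) ?_
    (by rwa [Finset.erase_insert hx])
  rintro b hb ⟨z, hz, hzx, hbz⟩
  exact absurd hbz (h z ((Finset.mem_insert.1 hz).resolve_left hzx) b hb)

lemma Dismantlable.union {X Y : Finset V} (hX : Dismantlable G X) (hY : Dismantlable G Y)
    (hd : Disjoint X Y) (h : ∀ x ∈ X, ∀ y ∈ Y, ∀ b, G.Adj b x → ¬ G.Adj b y) :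
    Dismantlable G (X ∪ Y) := by
  induction hX with
  | @base X hX =>
    rcases Nat.le_one_iff_eq_zero_or_eq_one.1 hX with hX | hX
    · simpa [Finset.card_eq_zero.1 hX] using hY
    · obtain ⟨x, rfl⟩ := Finset.card_eq_one.1 hX
      exact hY.insert (by simpa using hd) (h x (by simp))
  | @step X a a' ha ha' hne hred _ ih =>
    refine .step (a := a) (a' := a') (by simp [ha]) (by simp [ha']) hne ?_ ?_
    · rintro b hb ⟨x, hx, hxa, hbx⟩
      rcases Finset.mem_union.1 hx with hx | hx
      · exact hred b hb ⟨x, hx, hxa, hbx⟩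
      · exact absurd hbx (h a ha x hx b hb)
    · rw [Finset.erase_union_distrib, Finset.erase_eq_of_notMem (Finset.disjoint_left.1 hd ha)]
      exact ih (hd.mono_left (Finset.erase_subset _ _))
        fun x hx => h x (Finset.mem_of_mem_erase hx)

end Dismantling

/-! ### Sides of a bipartition -/

section Sides

variable {V : Type u} {G : SimpleGraph V}

/-- The neighbourhoods of distinct vertices of `K` within the neighbourhood of `r` are
incomparable. -/
def IsTraceAntichain (G : SimpleGraph V) (r : V) (K : Finset V) : Prop :=
  ∀ x ∈ K, ∀ y ∈ K, x ≠ y → ∃ b, G.Adj r b ∧ G.Adj b x ∧ ¬ G.Adj b y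

/-- The sets `N(x) ∩ N(r)`, ordered by inclusion, have width at most `k`. -/
def TraceWidthLE (G : SimpleGraph V) (k : ℕ) (r : V) : Prop :=
  ∀ K : Finset V, IsTraceAntichain G r K → K.card ≤ k

/-- The set `D` is a union of components on which `A` is one side of a bipartition. -/
structure IsSide (G : SimpleGraph V) (A D : Finset V) : Prop where
  closed : ∀ x ∈ D, ∀ y, G.Adj x y → y ∈ D
  cross : ∀ x ∈ D, ∀ y, G.Adj x y → (x ∈ A ↔ y ∉ A)

variable [DecidableEq V] {A B D E : Finset V} {k : ℕ}

/-- The side `A` of the union `D` of components admits a branch decomposition of mim-width at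
most `k` by merging its vertices. -/
structure IsGoodSide (G : SimpleGraph V) (k : ℕ) (A D : Finset V) : Prop extends
    IsSide G A D where
  subset : A ⊆ D
  dismantlable : Dismantlable G A
  width : ∀ r ∈ A, TraceWidthLE G k r

lemma isGoodSide_empty : IsGoodSide G k ∅ ∅ where
  closed := by simp
  cross := by simp
  subset := subset_rfl
  dismantlable := .base (by simp)
  width := by simp

lemma IsGoodSide.union (hA : IsGoodSide G k A D) (hB : IsGoodSide G k B E) (hd : Disjoint D E) :
    IsGoodSide G k (A ∪ B) (D ∪ E) where
  closed x hx y hxy := by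
    rw [Finset.mem_union] at hx ⊢
    exact hx.imp (fun hx => hA.closed x hx y hxy) fun hx => hB.closed x hx y hxy
  cross x hx y hxy := by
    rw [Finset.mem_union, Finset.mem_union]
    rcases Finset.mem_union.1 hx with hx | hx
    · have notMem (z : V) (hz : z ∈ D) : z ∉ B := fun h =>
        Finset.disjoint_left.1 hd hz (hB.subset h)
      simp [notMem x hx, notMem y (hA.closed x hx y hxy), hA.cross x hx y hxy]
    · have notMem (z : V) (hz : z ∈ E) : z ∉ A := fun h =>
        Finset.disjoint_right.1 hd hz (hA.subset h)
      simp [notMem x hx, notMem y (hB.closed x hx y hxy), hB.cross x hx y hxy]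
  subset := Finset.union_subset_union hA.subset hB.subset
  dismantlable := hA.dismantlable.union hB.dismantlable
    (hd.mono hA.subset hB.subset) fun x hx y hy b hbx hby => by
      have hb : b ∈ D := hA.closed x (hA.subset hx) b hbx.symm
      exact Finset.disjoint_left.1 hd (hA.closed b hb y hby) (hB.subset hy)
  width r hr := (Finset.mem_union.1 hr).elim (hA.width r) (hB.width r)

lemma IsGoodSide.inter (hA : IsGoodSide G k A D) (hE : ∀ x ∈ E, ∀ y, G.Adj x y → y ∈ E) :
    IsGoodSide G k (A ∩ E) (D ∩ E) where
  closed x hx y hxy := by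
    rw [Finset.mem_inter] at hx ⊢
    exact ⟨hA.closed x hx.1 y hxy, hE x hx.2 y hxy⟩
  cross x hx y hxy := by
    rw [Finset.mem_inter] at hx
    simp [hx.2, hE x hx.2 y hxy, hA.cross x hx.1 y hxy]
  subset := Finset.inter_subset_inter_right hA.subset
  dismantlable := by
    rw [← Finset.filter_mem_eq_inter]
    exact hA.dismantlable.filter (· ∈ E) fun x y hx => hE x hx y
  width r hr := hA.width r (Finset.mem_inter.1 hr).1

lemma IsGoodSide.univ_of_subset [Fintype V] (hA : IsGoodSide G k A D)
    (hB : IsSide G B Finset.univ) (hBD : B ⊆ D) : IsGoodSide G k A Finset.univ where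
  closed _ _ _ _ := Finset.mem_univ _
  cross x _ y hxy := by
    refine hA.cross x ?_ y hxy
    by_cases hx : x ∈ B
    · exact hBD hx
    · refine hA.closed y (hBD ?_) x hxy.symm
      have := hB.cross x (Finset.mem_univ x) y hxy
      tauto
  subset := Finset.subset_univ A
  dismantlable := hA.dismantlable
  width := hA.width

end Sides

lemma apply_iterate_card_eq {α : Type*} [Fintype α] {f : Finset α → Finset α}
    (hf : ∀ S, S ⊆ f S) (S : Finset α) :
    f (f^[Fintype.card α] S) = f^[Fintype.card α] S := by
  have H (i : ℕ) : f (f^[i] S) = f^[i] S ∨ i ≤ (f^[i] S).card := by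
    induction i with
    | zero => simp
    | succ i ih =>
      rw [Function.iterate_succ_apply']
      by_cases hfix : f (f^[i] S) = f^[i] S
      · rw [hfix]
        exact .inl hfix
      · have hlt := Finset.card_lt_card ((hf (f^[i] S)).ssubset_of_ne (Ne.symm hfix))
        exact .inr ((ih.resolve_left hfix).trans_lt hlt)
  refine (H (Fintype.card α)).elim id fun hcard => ?_
  have huniv := Finset.eq_univ_of_card _ (hcard.antisymm (Finset.card_le_univ _)).symm
  rw [huniv, Finset.univ_subset_iff.1 (hf Finset.univ)]

section EvenComponent

variable {V : Type u} [Fintype V] {G : SimpleGraph V} {A S : Finset V} {k : ℕ} {w : V}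

open Classical in
/-- The vertices at distance `0` or `2` from `S`, up to repeated vertices. -/
noncomputable def evenStep (G : SimpleGraph V) (S : Finset V) : Finset V :=
  Finset.univ.filter fun v => v ∈ S ∨ ∃ x ∈ S, ∃ y, G.Adj x y ∧ G.Adj y v

open Classical in
/-- The vertices that can be reached from `w` by a walk of even length. In a bipartite graph this
is the side of `w` in its component. -/
noncomputable def evenComponent (G : SimpleGraph V) (w : V) : Finset V :=
  (evenStep G)^[Fintype.card V] {w}

open Classical in
/-- The vertices in `S` or adjacent to a vertex in `S`. -/
noncomputable def closedNeighborhood (G : SimpleGraph V) (S : Finset V) : Finset V :=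
  Finset.univ.filter fun v => v ∈ S ∨ ∃ x ∈ S, G.Adj x v

lemma mem_evenStep {v : V} :
    v ∈ evenStep G S ↔ v ∈ S ∨ ∃ x ∈ S, ∃ y, G.Adj x y ∧ G.Adj y v := by
  simp [evenStep]

lemma mem_closedNeighborhood {v : V} :
    v ∈ closedNeighborhood G S ↔ v ∈ S ∨ ∃ x ∈ S, G.Adj x v := by
  simp [closedNeighborhood]

lemma evenComponent_induction {P : V → Prop} (hw : P w)
    (hP : ∀ x y z, P x → G.Adj x y → G.Adj y z → P z) : ∀ v ∈ evenComponent G w, P v := by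
  unfold evenComponent
  generalize Fintype.card V = i
  induction i with
  | zero => simpa using hw
  | succ i ih =>
    intro v hv
    rw [Function.iterate_succ_apply', mem_evenStep] at hv
    obtain hv | ⟨x, hx, y, hxy, hyv⟩ := hv
    · exact ih v hv
    · exact hP x y v (ih x hx) hxy hyv

lemma evenStep_evenComponent : evenStep G (evenComponent G w) = evenComponent G w := by
  classical
  unfold evenComponent
  exact apply_iterate_card_eq (fun S v hv => mem_evenStep.2 (.inl hv)) {w}

lemma mem_evenComponent_of_adj {x y z : V} (hx : x ∈ evenComponent G w) (hxy : G.Adj x y)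
    (hyz : G.Adj y z) : z ∈ evenComponent G w := by
  rw [← evenStep_evenComponent, mem_evenStep]
  exact .inr ⟨x, hx, y, hxy, hyz⟩

lemma self_mem_evenComponent : w ∈ evenComponent G w := by
  classical
  unfold evenComponent
  generalize Fintype.card V = i
  induction i with
  | zero => simp
  | succ i ih =>
    rw [Function.iterate_succ_apply', mem_evenStep]
    exact .inl ih

lemma evenComponent_subset_closedNeighborhood :
    evenComponent G w ⊆ closedNeighborhood G (evenComponent G w) :=
  fun _ hv => mem_closedNeighborhood.2 (.inl hv)

lemma closedNeighborhood_evenComponent_closed :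
    ∀ x ∈ closedNeighborhood G (evenComponent G w), ∀ y, G.Adj x y →
      y ∈ closedNeighborhood G (evenComponent G w) := by
  intro x hx y hxy
  rw [mem_closedNeighborhood] at hx ⊢
  obtain hx | ⟨z, hz, hzx⟩ := hx
  · exact .inr ⟨x, hx, hxy⟩
  · exact .inl (mem_evenComponent_of_adj hz hzx hxy)

lemma mem_iff_of_mem_evenComponent (hA : IsSide G A Finset.univ) {v : V}
    (hv : v ∈ evenComponent G w) : v ∈ A ↔ w ∈ A :=
  evenComponent_induction (P := fun v => v ∈ A ↔ w ∈ A) Iff.rfl (fun x y z hx hxy hyz => by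
    have := hA.cross x (Finset.mem_univ x) y hxy
    have := hA.cross y (Finset.mem_univ y) z hyz
    tauto) v hv

lemma isSide_evenComponent (hA : IsSide G A Finset.univ) :
    IsSide G (evenComponent G w) (closedNeighborhood G (evenComponent G w)) where
  closed := closedNeighborhood_evenComponent_closed
  cross x hx y hxy := by
    have not_both {x y : V} (hxy : G.Adj x y) (hx : x ∈ evenComponent G w) :
        y ∉ evenComponent G w := fun hy => by
      have := hA.cross x (Finset.mem_univ x) y hxy
      rw [mem_iff_of_mem_evenComponent hA hx, mem_iff_of_mem_evenComponent hA hy] at this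
      tauto
    refine ⟨not_both hxy, fun hy => ?_⟩
    obtain hx | ⟨z, hz, hzx⟩ := mem_closedNeighborhood.1 hx
    · exact hx
    · exact absurd (mem_evenComponent_of_adj hz hzx hxy) hy

lemma IsGoodSide.evenComponent [DecidableEq V] (hA : IsGoodSide G k A Finset.univ) (hw : w ∈ A) :
    IsGoodSide G k (evenComponent G w) (closedNeighborhood G (TreeConvex.evenComponent G w)) := by
  have hE : A ∩ closedNeighborhood G (TreeConvex.evenComponent G w) =
      TreeConvex.evenComponent G w := by
    ext v
    rw [Finset.mem_inter]
    refine ⟨fun ⟨hvA, hv⟩ => ?_, fun hv =>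
      ⟨(mem_iff_of_mem_evenComponent hA.toIsSide hv).2 hw,
        evenComponent_subset_closedNeighborhood hv⟩⟩
    obtain hv | ⟨x, hx, hxv⟩ := mem_closedNeighborhood.1 hv
    · exact hv
    · have hxA := (mem_iff_of_mem_evenComponent hA.toIsSide hx).2 hw
      exact absurd hvA ((hA.cross x (Finset.mem_univ x) v hxv).1 hxA)
  have := hA.inter (closedNeighborhood_evenComponent_closed (w := w))
  rwa [hE, Finset.univ_inter] at this

end EvenComponent

/-! ### Merging -/

section Merging

variable {V : Type u} {G : SimpleGraph V}

/-- The vertex `u` may be merged into `v`, where `R` is the set of remaining vertices and `A` is a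
side of the graph: either `u ∈ A` is dominated by `v ∈ A` or `u ∉ A` has no neighbour but `v`. -/
structure CanMerge (G : SimpleGraph V) (A R : Finset V) (u v : V) : Prop where
  left : u ∈ R
  right : v ∈ R
  ne : u ≠ v
  mem : u ∈ A → v ∈ A
  dom : u ∈ A → ∀ z ∈ R, G.Adj u z → G.Adj v z
  pendant : u ∉ A → ∀ z ∈ R, G.Adj u z → z = v

variable [DecidableEq V] {A R₀ R : Finset V} {u v : V}

/-- The invariant of the merging process, started with the set `R₀` of vertices. -/
structure MergeInv (G : SimpleGraph V) (A R₀ R : Finset V) : Prop where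
  subset : R ⊆ R₀
  pendant : ∀ b ∈ R₀, b ∉ R → b ∉ A → ∀ x ∈ R, ∀ y ∈ R, G.Adj b x → G.Adj b y → x = y
  dismantlable_iff : Dismantlable G (R ∩ A) ↔ Dismantlable G (R₀ ∩ A)

lemma mergeInv_refl : MergeInv G A R₀ R₀ :=
  ⟨subset_rfl, fun _ hb hb' => absurd hb hb', Iff.rfl⟩

lemma CanMerge.reducible (h : MergeInv G A R₀ R) (hs : IsSide G A R₀) (huv : CanMerge G A R u v)
    (hu : u ∈ A) : Reducible G (R ∩ A) u v := by
  rintro b hb ⟨x, hx, hxu, hbx⟩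
  rw [Finset.mem_inter] at hx
  have hbR₀ := hs.closed u (h.subset huv.left) b hb.symm
  have hbA := (hs.cross u (h.subset huv.left) b hb.symm).1 hu
  by_cases hbR : b ∈ R
  · exact (huv.dom hu b hbR hb.symm).symm
  · exact absurd (h.pendant b hbR₀ hbR hbA x hx.1 u huv.left hbx hb) hxu

lemma MergeInv.erase (h : MergeInv G A R₀ R) (hs : IsSide G A R₀) (huv : CanMerge G A R u v) :
    MergeInv G A R₀ (R.erase u) where
  subset := (Finset.erase_subset _ _).trans h.subset
  pendant b hb hbR hbA x hx y hy hbx hby := by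
    rw [Finset.mem_erase] at hx hy
    by_cases hbu : b = u
    · subst hbu
      rw [huv.pendant hbA x hx.2 hbx, huv.pendant hbA y hy.2 hby]
    · exact h.pendant b hb (fun hb' => hbR (by simp [hb', hbu])) hbA x hx.2 y hy.2 hbx hby
  dismantlable_iff := by
    rw [← h.dismantlable_iff, Finset.erase_inter]
    by_cases hu : u ∈ A
    · exact dismantlable_erase_iff (by simp [hu, huv.left]) (by simp [huv.mem hu, huv.right])
        huv.ne (huv.reducible h hs hu)
    · rw [Finset.erase_eq_of_notMem (by simp [hu])]

lemma MergeInv.exists_ne_adj (h : MergeInv G A R₀ R) (hs : IsSide G A R₀)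
    (stuck : ∀ u v, ¬ CanMerge G A R u v) (hR : 1 < R.card) {b : V} (hb : b ∈ R) (hbA : b ∉ A)
    (a : V) : ∃ x ∈ R ∩ A, x ≠ a ∧ G.Adj b x := by
  have not_pendant (v : V) (hv : v ∈ R) (hvb : v ≠ b) : ∃ z ∈ R, G.Adj b z ∧ z ≠ v := by
    by_contra! hcon
    exact stuck b v ⟨hb, hv, hvb.symm, fun h => absurd h hbA, fun h => absurd h hbA, fun _ => hcon⟩
  obtain ⟨v, hv, hvb⟩ := Finset.exists_mem_ne hR b
  obtain ⟨x, hx, hbx, -⟩ := not_pendant v hv hvb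
  obtain ⟨y, hy, hby, hyx⟩ := not_pendant x hx hbx.ne'
  have mem_side (z : V) (hbz : G.Adj b z) : z ∈ A := by
    by_contra hz
    exact hbA ((hs.cross b (h.subset hb) z hbz).2 hz)
  by_cases hxa : x = a
  · exact ⟨y, by simp [hy, mem_side y hby], hxa ▸ hyx, hby⟩
  · exact ⟨x, by simp [hx, mem_side x hbx], hxa, hbx⟩

lemma MergeInv.dismantlable_iff_card_le_one (h : MergeInv G A R₀ R) (hs : IsSide G A R₀)
    (stuck : ∀ u v, ¬ CanMerge G A R u v) : Dismantlable G (R₀ ∩ A) ↔ R.card ≤ 1 := by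
  rw [← h.dismantlable_iff]
  refine ⟨fun hd => ?_, fun hR =>
    .base ((Finset.card_le_card Finset.inter_subset_left).trans hR)⟩
  by_contra! hR
  have two {b : V} := h.exists_ne_adj hs stuck hR (b := b)
  cases hd with
  | base hd =>
    obtain ⟨b, hb, hbA⟩ : ∃ b ∈ R, b ∉ A := by
      by_contra! hcon
      rw [Finset.inter_eq_left.2 hcon] at hd
      omega
    obtain ⟨x, hx, -⟩ := two hb hbA b
    obtain ⟨y, hy, hyx, -⟩ := two hb hbA x
    exact hyx (Finset.card_le_one.1 hd y hy x hx)
  | @step _ a a' ha ha' hne hred _ =>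
    rw [Finset.mem_inter] at ha ha'
    refine stuck a a' ⟨ha.1, ha'.1, hne, fun _ => ha'.2, fun _ z hz haz => ?_,
      fun h => absurd ha.2 h⟩
    have hzA := (hs.cross a (h.subset ha.1) z haz).1 ha.2
    exact (hred z haz.symm (two hz hzA a)).symm

end Merging

/-! ### Cuts -/

section Cuts

variable {V : Type u} {G : SimpleGraph V} {X : Set V} {v : V}

lemma cutMim_compl (X : Set V) : cutMim G Xᶜ = cutMim G X := by
  unfold cutMim
  rw [compl_compl, SimpleGraph.between_comm]

lemma exists_of_mem_edgeSet_between {e : Sym2 V} (he : e ∈ (G.between X Xᶜ).edgeSet) :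
    ∃ x ∈ X, ∃ y ∉ X, G.Adj x y ∧ e = s(x, y) := by
  induction e with
  | _ x y =>
    obtain ⟨hxy, ⟨hx, hy⟩ | ⟨hx, hy⟩⟩ := SimpleGraph.between_adj.1 he
    · exact ⟨x, hx, y, hy, hxy, rfl⟩
    · exact ⟨y, hy, x, hx, hxy.symm, Sym2.eq_swap⟩

lemma cutMim_le_one (h : ∀ x ∈ X, ∀ y ∉ X, G.Adj x y → x = v) : cutMim G X ≤ 1 := by
  refine iSup₂_le fun M hM => Set.encard_le_one_iff.2 fun e f he hf => ?_
  have mem_of_mem (e : Sym2 V) (he : e ∈ M) : v ∈ e := by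
    obtain ⟨x, hx, y, hy, hxy, rfl⟩ := exists_of_mem_edgeSet_between (hM.1 he)
    simp [h x hx y hy hxy]
  by_contra hne
  exact (hM.2 e he f hf hne v (mem_of_mem e he) v (mem_of_mem f hf)).1 rfl

lemma cutMim_le_of_traceWidthLE [Finite V] {k : ℕ} (hv : TraceWidthLE G k v)
    (h : ∀ x ∈ X, ∀ y ∉ X, G.Adj x y → G.Adj v y) : cutMim G X ≤ k := by
  classical
  refine iSup₂_le fun M hM => ?_
  choose x hx y hy hxy he using fun e : M => exists_of_mem_edgeSet_between (hM.1 e.2)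
  have x_mem (e : M) : x e ∈ e.1 := by simp [he e]
  have y_mem (e : M) : y e ∈ e.1 := by simp [he e]
  have induced (e f : M) (hef : e ≠ f) := hM.2 e e.2 f f.2 (Subtype.coe_injective.ne hef)
  have x_injective : x.Injective := fun e f hef => by
    by_contra hne
    exact (induced e f hne _ (x_mem e) _ (x_mem f)).1 hef
  have := Fintype.ofFinite M
  have antichain : IsTraceAntichain G v (Finset.univ.image x) := by
    simp only [IsTraceAntichain, Finset.forall_mem_image]
    intro e _ f _ hne
    refine ⟨y e, h _ (hx e) _ (hy e) (hxy e), (hxy e).symm, fun hadj => ?_⟩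
    exact (induced e f (ne_of_apply_ne x hne) _ (y_mem e) _ (x_mem f)).2
      (SimpleGraph.between_adj.2 ⟨hadj, .inr ⟨hy e, hx f⟩⟩)
  have hcard := hv _ antichain
  rw [Finset.card_image_of_injective _ x_injective, Finset.card_univ] at hcard
  rw [Set.encard, ENat.card_eq_coe_fintype_card]
  exact_mod_cast hcard

end Cuts

section Clusters

variable {V : Type u} {G : SimpleGraph V} {A R : Finset V} {rep : V → V} {u v : V}

/-- The clusters of the merging process: `rep x` is the remaining vertex into which `x` has been
merged. All edges between different clusters lead to a remaining vertex outside of `A`. -/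
structure ClusterInv (G : SimpleGraph V) (A R : Finset V) (rep : V → V) : Prop where
  rep_mem : ∀ x, rep x ∈ R
  rep_self : ∀ x ∈ R, rep x = x
  edge : ∀ a ∈ A, ∀ b, b ∉ A → G.Adj a b → rep a ≠ rep b → b ∈ R ∧ rep a ∈ A ∧ G.Adj (rep a) b

lemma clusterInv_id [Fintype V] (A : Finset V) : ClusterInv G A Finset.univ id :=
  ⟨fun _ => Finset.mem_univ _, fun _ _ => rfl, fun _ ha _ _ hab _ =>
    ⟨Finset.mem_univ _, ha, hab⟩⟩

lemma ClusterInv.merge [DecidableEq V] (h : ClusterInv G A R rep) (huv : CanMerge G A R u v) :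
    ClusterInv G A (R.erase u) fun x => if rep x = u then v else rep x where
  rep_mem x := by
    split_ifs with hx
    · simp [huv.right, huv.ne.symm]
    · simp [hx, h.rep_mem x]
  rep_self x hx := by
    rw [Finset.mem_erase] at hx
    simp [h.rep_self x hx.2, hx.1]
  edge a ha b hb hab hne := by
    obtain ⟨hbR, haA, hadj⟩ := h.edge a ha b hb hab fun he => hne (by simp [he])
    by_cases hbu : b = u
    · subst hbu
      refine absurd ?_ hne
      simp [huv.pendant hb _ (h.rep_mem a) hadj.symm, h.rep_self b hbR]
    · refine ⟨by simp [hbu, hbR], ?_⟩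
      by_cases hau : rep a = u
      · rw [hau] at haA hadj
        simpa [hau] using ⟨huv.mem haA, huv.dom haA b hbR hadj⟩
      · simpa [hau] using ⟨haA, hadj⟩

lemma ClusterInv.cutMim_le [Fintype V] (h : ClusterInv G A R rep) (hA : IsSide G A Finset.univ)
    {k : ℕ} (hk : 1 ≤ k) (hw : v ∈ A → TraceWidthLE G k v) : cutMim G {x | rep x = v} ≤ k := by
  have eq_of_notMem {x y : V} (hx : rep x = v) (hy : rep y ≠ v) (hxy : G.Adj x y) (hxA : x ∉ A) :
      x = v := by
    have hyA : y ∈ A := (hA.cross y (Finset.mem_univ y) x hxy.symm).2 hxA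
    obtain ⟨hxR, -⟩ := h.edge y hyA x hxA hxy.symm fun he => hy (he.trans hx)
    exact (h.rep_self x hxR).symm.trans hx
  have adj_of_mem {x y : V} (hx : rep x = v) (hy : rep y ≠ v) (hxy : G.Adj x y) (hxA : x ∈ A) :
      v ∈ A ∧ G.Adj v y := by
    have hyA : y ∉ A := (hA.cross x (Finset.mem_univ x) y hxy).1 hxA
    obtain ⟨-, hadj⟩ := h.edge x hxA y hyA hxy fun he => hy (he.symm.trans hx)
    rwa [hx] at hadj
  by_cases hv : v ∈ A
  · refine cutMim_le_of_traceWidthLE (hw hv) fun x hx y hy hxy => ?_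
    by_cases hxA : x ∈ A
    · exact (adj_of_mem hx hy hxy hxA).2
    · exact absurd (eq_of_notMem hx hy hxy hxA ▸ hv) hxA
  · refine (cutMim_le_one (v := v) fun x hx y hy hxy => ?_).trans (by exact_mod_cast hk)
    exact eq_of_notMem hx hy hxy fun hxA => hv (adj_of_mem hx hy hxy hxA).1

end Clusters

/-! ### Branch decompositions from parent functions -/

/-- The function `par` maps the nodes of a rooted binary tree with nodes `0, …, m - 1` and leaves
`0, …, n - 1` to their parents; the root is mapped to a number that is not a node. -/
structure IsParentMap (n m : ℕ) (par : ℕ → ℕ) : Prop where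
  pos : 0 < n
  le : n ≤ m
  lt_par : ∀ x < m, x < par x
  le_par : ∀ x < m, n ≤ par x
  par_lt : ∀ x, x + 1 < m → par x < m
  two : ∀ c, n ≤ c → c < m →
    ∃ y z, y ≠ z ∧ y < m ∧ z < m ∧ ∀ w < m, par w = c ↔ w = y ∨ w = z

namespace IsParentMap

variable {n m : ℕ} {par : ℕ → ℕ} (h : IsParentMap n m par)

/-- The tree of a parent function. -/
def graph (h : IsParentMap n m par) : SimpleGraph (Fin m) where
  Adj x y := par x = y ∨ par y = x
  symm := ⟨fun _ _ => Or.symm⟩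
  loopless := ⟨fun x hx => by
    have := h.lt_par x x.2
    omega⟩

/-- The node `y` is a descendant of `x`. -/
def Desc (par : ℕ → ℕ) (y x : Fin m) : Prop :=
  Relation.ReflTransGen (fun a b : Fin m => par a = b) y x

include h

lemma le_of_desc {y x : Fin m} (hyx : Desc par y x) : (y : ℕ) ≤ x := by
  induction hyx with
  | refl => exact le_rfl
  | @tail a b _ hab ih => exact ih.trans (hab ▸ (h.lt_par a a.2).le)

lemma not_desc_of_par_eq {x p : Fin m} (hp : par x = p) : ¬ Desc par p x := fun hd =>
  (h.le_of_desc hd).not_gt (hp ▸ h.lt_par x x.2)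

lemma deleteEdges_adj {x p y q : Fin m} (hp : par x = p) (hq : par y = q) (hyx : y ≠ x) :
    (h.graph.deleteEdges {s(x, p)}).Adj y q := by
  rw [SimpleGraph.deleteEdges_adj]
  refine ⟨Or.inl hq, fun he => ?_⟩
  rcases Sym2.eq_iff.1 (Set.mem_singleton_iff.1 he) with ⟨hyx', -⟩ | ⟨rfl, rfl⟩
  · exact hyx hyx'
  · have := h.lt_par q q.2
    have := h.lt_par y y.2
    omega

lemma reachable_of_desc {x p y : Fin m} (hp : par x = p) (hy : Desc par y x) :
    (h.graph.deleteEdges {s(x, p)}).Reachable x y := by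
  induction hy using Relation.ReflTransGen.head_induction_on with
  | refl => exact .refl _
  | @head a c hac hc ih =>
    refine ih.trans (h.deleteEdges_adj hp hac ?_).symm.reachable
    rintro rfl
    exact h.not_desc_of_par_eq hac hc

lemma reachable_last (q : Fin m → Prop) (T : SimpleGraph (Fin m))
    (hT : ∀ y z : Fin m, q y → par y = z → T.Adj y z ∧ q z) (y : Fin m) (hy : q y) :
    T.Reachable y ⟨m - 1, by have := y.2; omega⟩ := by
  induction hd : m - (y : ℕ) using Nat.strong_induction_on generalizing y with
  | _ d ih =>
    by_cases hlast : (y : ℕ) + 1 < m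
    · have hlt := h.lt_par y y.2
      obtain ⟨hadj, hq⟩ := hT y ⟨par y, h.par_lt y hlast⟩ hy rfl
      exact hadj.reachable.trans (ih (m - par y) (by omega) ⟨par y, h.par_lt y hlast⟩ hq rfl)
    · rw [show y = ⟨m - 1, by omega⟩ from Fin.ext (show (y : ℕ) = m - 1 by omega)]

lemma connected : h.graph.Connected := by
  have hlast (y : Fin m) := h.reachable_last (fun _ => True) h.graph
    (fun y z _ hz => ⟨Or.inl hz, trivial⟩) y trivial
  exact (SimpleGraph.connected_iff _).2
    ⟨fun x y => (hlast x).trans (hlast y).symm, ⟨0, h.pos.trans_le h.le⟩⟩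

lemma reachable_of_not_desc {x p y : Fin m} (hp : par x = p) (hy : ¬ Desc par y x) :
    (h.graph.deleteEdges {s(x, p)}).Reachable p y := by
  have hlast := h.reachable_last (fun y => ¬ Desc par y x) (h.graph.deleteEdges {s(x, p)})
    fun y z hy hz => ⟨h.deleteEdges_adj hp hz (by rintro rfl; exact hy .refl),
      fun hd => hy (.head hz hd)⟩
  exact (hlast p (h.not_desc_of_par_eq hp)).trans (hlast y hy).symm

lemma reachable_iff_desc {x p y : Fin m} (hp : par x = p) :
    (h.graph.deleteEdges {s(x, p)}).Reachable x y ↔ Desc par y x := by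
  refine ⟨fun hr => ?_, h.reachable_of_desc hp⟩
  rw [SimpleGraph.reachable_iff_reflTransGen] at hr
  induction hr with
  | refl => exact .refl
  | @tail a b _ hab ih =>
    obtain ⟨hpar | hpar, hne⟩ := SimpleGraph.deleteEdges_adj.1 hab
    · rcases Relation.ReflTransGen.cases_head ih with rfl | ⟨c, hc, hcx⟩
      · exact absurd (by rw [Fin.ext (hp.symm.trans hpar)]; rfl) hne
      · rwa [← Fin.ext (hc.symm.trans hpar)]
    · exact .head hpar ih

lemma reachable_iff_not_desc {x p y : Fin m} (hp : par x = p) :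
    (h.graph.deleteEdges {s(x, p)}).Reachable p y ↔ ¬ Desc par y x :=
  ⟨fun hr hd => h.not_desc_of_par_eq hp
    ((h.reachable_iff_desc hp).1 ((h.reachable_of_desc hp hd).trans hr.symm)),
    h.reachable_of_not_desc hp⟩

lemma isTree : h.graph.IsTree := by
  refine ⟨h.connected, SimpleGraph.isAcyclic_iff_forall_adj_isBridge.2 fun x y hxy => ?_⟩
  rcases hxy with hxy | hxy
  · rw [SimpleGraph.isBridge_iff, h.reachable_iff_desc hxy]
    exact h.not_desc_of_par_eq hxy
  · rw [Sym2.eq_swap, SimpleGraph.isBridge_iff, h.reachable_iff_desc hxy]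
    exact h.not_desc_of_par_eq hxy

omit h in
lemma encard_setOf_par_eq_le_one (x : Fin m) : {w : Fin m | par x = w}.encard ≤ 1 :=
  Set.encard_le_one_iff.2 fun _ _ ha hb => Fin.ext (ha.symm.trans hb)

lemma deg_le_one_of_lt {x : Fin m} (hx : (x : ℕ) < n) : deg h.graph x ≤ 1 :=
  (Set.encard_le_encard fun y hy => hy.resolve_right fun hyx =>
    (h.le_par y y.2).not_gt (hyx ▸ hx)).trans (encard_setOf_par_eq_le_one x)

lemma subcubic (x : Fin m) : deg h.graph x ≤ 3 := by
  by_cases hx : (x : ℕ) < n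
  · exact (h.deg_le_one_of_lt hx).trans (by norm_num)
  · obtain ⟨y, z, hne, hy, hz, hyz⟩ := h.two x (not_lt.1 hx) x.2
    have hsub : h.graph.neighborSet x ⊆ {w | par x = w} ∪ {⟨y, hy⟩, ⟨z, hz⟩} := fun w hw =>
      hw.imp id fun hwx => ((hyz w w.2).1 hwx).imp Fin.ext Fin.ext
    calc deg h.graph x
      _ ≤ ({w : Fin m | par x = w} : Set _).encard + ({⟨y, hy⟩, ⟨z, hz⟩} : Set (Fin m)).encard :=
        (Set.encard_le_encard hsub).trans (Set.encard_union_le _ _)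
      _ ≤ 1 + 2 :=
        add_le_add (encard_setOf_par_eq_le_one x) (Set.encard_pair (by simpa using hne)).le
      _ = 3 := by norm_num

lemma deg_le_one_iff (x : Fin m) : deg h.graph x ≤ 1 ↔ (x : ℕ) < n := by
  refine ⟨fun hd => ?_, h.deg_le_one_of_lt⟩
  by_contra hx
  obtain ⟨y, z, hyz, hy, hz, hpar⟩ := h.two x (not_lt.1 hx) x.2
  have heq := Set.encard_le_one_iff.1 hd ⟨y, hy⟩ ⟨z, hz⟩ (.inr ((hpar y hy).2 (.inl rfl)))
    (.inr ((hpar z hz).2 (.inr rfl)))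
  exact hyz (Fin.mk.inj_iff.1 heq)

omit h in
/-- The branch decomposition of a parent function. -/
def toBranchDecomposition (h : IsParentMap n m par) : BranchDecomposition (Fin n) where
  m := m
  T := h.graph
  isTree := h.isTree
  subcubic := h.subcubic
  δ :=
    { toFun := fun v => ⟨⟨v, v.2.trans_le h.le⟩, (h.deg_le_one_iff _).2 v.2⟩
      invFun := fun x => ⟨x.1, (h.deg_le_one_iff _).1 x.2⟩
      left_inv := fun _ => rfl
      right_inv := fun _ => rfl }

lemma desc_iff_mem {cl : ℕ → Set (Fin n)} (hleaf : ∀ v : Fin n, cl v = {v})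
    (hcl : ∀ c, n ≤ c → c < m → ∀ v, v ∈ cl c ↔ ∃ w < m, par w = c ∧ v ∈ cl w)
    (v : Fin n) (x : Fin m) : Desc par ⟨v, v.2.trans_le h.le⟩ x ↔ v ∈ cl x := by
  refine ⟨fun hd => ?_, fun hv => ?_⟩
  · induction hd with
    | refl => simp [hleaf]
    | @tail a b _ hab ih => exact (hcl b (hab ▸ h.le_par a a.2) b.2 v).2 ⟨a, a.2, hab, ih⟩
  · induction hd : (x : ℕ) using Nat.strong_induction_on generalizing x with
    | _ d ih =>
      by_cases hx : (x : ℕ) < n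
      · rw [show cl x = {⟨x, hx⟩} from hleaf ⟨x, hx⟩] at hv
        rw [Set.mem_singleton_iff.1 hv]
        exact .refl
      · obtain ⟨w, hw, hwx, hvw⟩ := (hcl x (not_lt.1 hx) x.2 v).1 hv
        have hlt := h.lt_par w hw
        exact .tail (ih w (by omega) ⟨w, hw⟩ hvw rfl) hwx

lemma mimw_le {G : SimpleGraph (Fin n)} {k : ℕ} {cl : ℕ → Set (Fin n)}
    (hleaf : ∀ v : Fin n, cl v = {v})
    (hcl : ∀ c, n ≤ c → c < m → ∀ v, v ∈ cl c ↔ ∃ w < m, par w = c ∧ v ∈ cl w)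
    (hcut : ∀ x < m, cutMim G (cl x) ≤ k) : h.toBranchDecomposition.mimw G ≤ k := by
  refine iSup_le fun (x : Fin m) => iSup_le fun (y : Fin m) => iSup_le fun hxy => ?_
  rcases hxy with hxy | hxy
  · have hside : h.toBranchDecomposition.side x y = cl x := Set.ext fun v =>
      (h.reachable_iff_desc hxy).trans (h.desc_iff_mem hleaf hcl v x)
    rw [hside]
    exact hcut x x.2
  · have hside : h.toBranchDecomposition.side x y = (cl y)ᶜ := Set.ext fun v => by
      rw [Set.mem_compl_iff, ← h.desc_iff_mem hleaf hcl, ← h.reachable_iff_not_desc hxy,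
        Sym2.eq_swap]
      rfl
    rw [hside, cutMim_compl]
    exact hcut y y.2

end IsParentMap

/-! ### Rooted trees -/

section Rooted

variable {W : Type u} {H : SimpleGraph W} {r : W} {p : W → W} {d : W → ℕ}

/-- The functions `p` and `d` map the vertices of a tree with root `r` to their parents and to
their depths. -/
structure IsRooted (H : SimpleGraph W) (r : W) (p : W → W) (d : W → ℕ) : Prop where
  root : d r = 0
  adj : ∀ y, y ≠ r → H.Adj y (p y)
  lt : ∀ y, y ≠ r → d (p y) < d y
  edge : ∀ y z, H.Adj y z → (y ≠ r ∧ p y = z) ∨ (z ≠ r ∧ p z = y)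

lemma exists_adj_dist_eq_add_one (hH : H.IsTree) {y : W} (hy : y ≠ r) :
    ∃ z, H.Adj y z ∧ H.dist r y = H.dist r z + 1 := by
  obtain ⟨w, hw⟩ := (hH.connected y r).exists_walk_length_eq_dist
  cases w with
  | nil => exact absurd rfl hy
  | @cons _ z _ hyz q =>
    refine ⟨z, hyz, (hH.dist_eq_dist_add_one_of_adj r hyz).resolve_right fun hz => ?_⟩
    have hq := SimpleGraph.dist_le q
    rw [SimpleGraph.Walk.length_cons, SimpleGraph.dist_comm] at hw
    rw [SimpleGraph.dist_comm] at hq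
    omega

lemma eq_of_adj_of_dist_eq_add_one (hH : H.IsTree) {y z z' : W} (hz : H.Adj y z)
    (hz' : H.Adj y z') (hd : H.dist r y = H.dist r z + 1) (hd' : H.dist r y = H.dist r z' + 1) :
    z = z' := by
  have exists_path {x : W} (hx : H.Adj y x) (hdx : H.dist r y = H.dist r x + 1) :
      ∃ q : H.Walk x r, (SimpleGraph.Walk.cons hx q).IsPath := by
    obtain ⟨q, hq⟩ := (hH.connected x r).exists_walk_length_eq_dist
    refine ⟨q, SimpleGraph.Walk.isPath_of_length_eq_dist _ ?_⟩
    rw [SimpleGraph.Walk.length_cons, hq, SimpleGraph.dist_comm, ← hdx, SimpleGraph.dist_comm]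
  obtain ⟨q, hq⟩ := exists_path hz hd
  obtain ⟨q', hq'⟩ := exists_path hz' hd'
  injection (hH.existsUnique_path y r).unique hq hq'

lemma exists_isRooted (hH : H.IsTree) (r : W) : ∃ p d, IsRooted H r p d := by
  classical
  choose! p hadj hdist using fun y => exists_adj_dist_eq_add_one (y := y) (r := r) hH
  have eq_parent {y z : W} (hyz : H.Adj y z) (hd : H.dist r y = H.dist r z + 1) :
      y ≠ r ∧ p y = z := by
    have hy : y ≠ r := by
      rintro rfl
      simp at hd
    exact ⟨hy, eq_of_adj_of_dist_eq_add_one hH (hadj y hy) hyz (hdist y hy) hd⟩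
  exact ⟨p, H.dist r, SimpleGraph.dist_self, hadj, fun y hy => by have := hdist y hy; omega,
    fun y z hyz => (hH.dist_eq_dist_add_one_of_adj r hyz).imp (eq_parent hyz) (eq_parent hyz.symm)⟩

/-- The vertex `y` is an ancestor of `x`, where `p` maps vertices other than the root `r` to their
parents. -/
def IsAncestor (r : W) (p : W → W) (x y : W) : Prop :=
  Relation.ReflTransGen (fun a b => a ≠ r ∧ p a = b) x y

/-- The vertex `y` is an ancestor of `x`, and no vertex of the path from `p x` to `y` is the root
or has degree at least `3`. -/
def IsChain (H : SimpleGraph W) (r : W) (p : W → W) (x y : W) : Prop :=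
  Relation.ReflTransGen (fun a b => a ≠ r ∧ p a = b ∧ b ≠ r ∧ ¬ 3 ≤ deg H b) x y

lemma IsChain.isAncestor {x y : W} (h : IsChain H r p x y) : IsAncestor r p x y :=
  Relation.ReflTransGen.mono (fun _ _ h => ⟨h.1, h.2.1⟩) x y h

lemma deg_eq_degree (w : W) [Fintype (H.neighborSet w)] : deg H w = H.degree w :=
  Set.encard_eq_coe_toFinset_card _

namespace IsRooted

variable (h : IsRooted H r p d)
include h

lemma le_of_isAncestor {x y : W} (hxy : IsAncestor r p x y) : d y ≤ d x := by
  induction hxy with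
  | refl => exact le_rfl
  | @tail a b _ hab ih => exact (hab.2 ▸ (h.lt a hab.1).le).trans ih

lemma parent_mem {S : Set W} (hS : (H.induce S).Preconnected) {τ x : W} (hτ : τ ∈ S)
    (hmin : ∀ y ∈ S, d τ ≤ d y) (hx : x ∈ S) (hxτ : x ≠ τ) : x ≠ r ∧ p x ∈ S := by
  by_contra hcon
  have ancestor (y : S) (hy : (H.induce S).Reachable ⟨x, hx⟩ y) : IsAncestor r p y x := by
    rw [SimpleGraph.reachable_iff_reflTransGen] at hy
    induction hy with
    | refl => exact .refl
    | @tail a b _ hab ih =>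
      rcases h.edge a b hab with ⟨har, hpa⟩ | hb
      · rcases Relation.ReflTransGen.cases_head ih with hax | ⟨c, ⟨-, hc⟩, hcx⟩
        · exact absurd ⟨hax ▸ har, hax ▸ hpa ▸ b.2⟩ hcon
        · rwa [← hpa, hc]
      · exact .head hb ih
  rcases Relation.ReflTransGen.cases_head (ancestor ⟨τ, hτ⟩ (hS _ _)) with
    heq | ⟨_, ⟨hr, rfl⟩, hcx⟩
  · exact hxτ heq.symm
  · have := h.lt τ hr
    have : d x ≤ d (p τ) := h.le_of_isAncestor hcx
    have : d τ ≤ d x := hmin x hx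
    omega

lemma exists_isChain {a : W} (ha : a ≠ r) :
    ∃ x, x ≠ r ∧ (p x = r ∨ 3 ≤ deg H (p x)) ∧ IsChain H r p a x := by
  induction hn : d a using Nat.strong_induction_on generalizing a with
  | _ n ih =>
    by_cases hp : p a = r ∨ 3 ≤ deg H (p a)
    · exact ⟨a, ha, hp, .refl⟩
    · rw [not_or] at hp
      obtain ⟨x, hxr, hpx, hx⟩ := ih (d (p a)) (hn ▸ h.lt a ha) hp.1 rfl
      exact ⟨x, hxr, hpx, .head ⟨ha, rfl, hp.1, hp.2⟩ hx⟩

lemma eq_of_parent_eq {a b : W} (ha : a ≠ r) (hb : b ≠ r) (hab : p a = p b) (hr : p a ≠ r)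
    (hdeg : ¬ 3 ≤ deg H (p a)) : a = b := by
  by_contra hne
  refine hdeg ?_
  have hsub : ({a, b, p (p a)} : Set W) ⊆ H.neighborSet (p a) := by
    rintro w (rfl | rfl | rfl)
    · exact (h.adj w ha).symm
    · exact hab ▸ (h.adj w hb).symm
    · exact h.adj _ hr
  have hlt := h.lt _ hr
  have ne_grandparent {x : W} (hx : x ≠ r) (hpx : p a = p x) : x ≠ p (p a) := fun he => by
    have := h.lt x hx
    rw [← hpx] at this
    rw [← he] at hlt
    omega
  calc 3 = ({a, b, p (p a)} : Set W).encard :=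
        (Set.encard_eq_three.2 ⟨a, b, p (p a), hne, ne_grandparent ha rfl, ne_grandparent hb hab,
          rfl⟩).symm
    _ ≤ deg H (p a) := Set.encard_le_encard hsub

lemma isChain_total {a b x : W} (ha : IsChain H r p a x) (hb : IsChain H r p b x) :
    IsChain H r p a b ∨ IsChain H r p b a := by
  have unique : Relator.RightUnique
      (Function.swap fun a b => a ≠ r ∧ p a = b ∧ b ≠ r ∧ ¬ 3 ≤ deg H b) := by
    rintro _ a b ⟨ha, rfl, hr, hdeg⟩ ⟨hb, hba, -⟩
    exact h.eq_of_parent_eq ha hb hba.symm hr hdeg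
  exact (Relation.ReflTransGen.total_of_right_unique unique (Relation.reflTransGen_swap.2 ha)
    (Relation.reflTransGen_swap.2 hb)).symm.imp Relation.reflTransGen_swap.1
    Relation.reflTransGen_swap.1

lemma card_le_of_branching_parent [Finite W] {t Δ : ℕ} (hΔ : ∀ w, deg H w ≤ Δ)
    (ht : {w | 3 ≤ deg H w}.encard ≤ t) {S : Finset W}
    (hS : ∀ x ∈ S, x ≠ r ∧ (p x = r ∨ 3 ≤ deg H (p x))) : S.card ≤ t * Δ + 2 := by
  classical
  have := Fintype.ofFinite W
  let branching : Finset W := Finset.univ.filter fun w => 3 ≤ deg H w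
  let rest : Finset W := if 3 ≤ deg H r then ∅ else H.neighborFinset r
  have branching_card : branching.card ≤ t := by
    have hcast : ((branching.card : ℕ) : ℕ∞) ≤ t := by
      rw [← Set.encard_coe_eq_coe_finsetCard]
      simpa [branching] using ht
    exact_mod_cast hcast
  have rest_card : rest.card ≤ 2 := by
    unfold rest
    split_ifs with hr
    · simp
    · rw [deg_eq_degree] at hr
      rw [H.card_neighborFinset_eq_degree]
      exact Nat.lt_succ_iff.1 (not_le.1 (by exact_mod_cast hr))
  have degree_le (w : W) : (H.neighborFinset w).card ≤ Δ := by
    rw [H.card_neighborFinset_eq_degree]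
    exact_mod_cast deg_eq_degree (H := H) w ▸ hΔ w
  have hsub : S ⊆ branching.biUnion (H.neighborFinset ·) ∪ rest := fun x hx => by
    obtain ⟨hxr, hpx⟩ := hS x hx
    have hadj : x ∈ H.neighborFinset (p x) := by simpa using (h.adj x hxr).symm
    by_cases hdeg : 3 ≤ deg H (p x)
    · exact Finset.mem_union_left _
        (Finset.mem_biUnion.2 ⟨_, by simpa [branching] using hdeg, hadj⟩)
    · have hroot := hpx.resolve_right hdeg
      rw [hroot] at hdeg hadj
      exact Finset.mem_union_right _ (by rwa [show rest = _ from if_neg hdeg])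
  calc S.card ≤ (branching.biUnion (H.neighborFinset ·)).card + rest.card :=
        (Finset.card_le_card hsub).trans (Finset.card_union_le _ _)
    _ ≤ t * Δ + 2 := Nat.add_le_add ((Finset.card_biUnion_le_card_mul _ _ Δ fun w _ =>
        degree_le w).trans (Nat.mul_le_mul_right _ branching_card)) rest_card

lemma card_le_of_incomparable [Finite W] {t Δ : ℕ} (hΔ : ∀ w, deg H w ≤ Δ)
    (ht : {w | 3 ≤ deg H w}.encard ≤ t) {K : Finset W} (hr : r ∉ K)
    (hK : ∀ x ∈ K, ∀ y ∈ K, x ≠ y → ¬ IsAncestor r p x y) : K.card ≤ t * Δ + 2 := by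
  classical
  choose! top top_ne top_parent top_chain using fun a => h.exists_isChain (a := a)
  have ne_root {a : W} (ha : a ∈ K) : a ≠ r := ne_of_mem_of_not_mem ha hr
  have top_injOn : Set.InjOn top K := by
    intro a ha b hb hab
    by_contra hne
    rcases h.isChain_total (top_chain a (ne_root ha)) (hab ▸ top_chain b (ne_root hb)) with hc | hc
    · exact hK a ha b hb hne hc.isAncestor
    · exact hK b hb a ha (Ne.symm hne) hc.isAncestor
  rw [← Finset.card_image_of_injOn top_injOn]
  refine h.card_le_of_branching_parent hΔ ht ?_
  simp only [Finset.forall_mem_image]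
  exact fun a ha => ⟨top_ne a (ne_root ha), top_parent a (ne_root ha)⟩

end IsRooted

end Rooted

/-! ### Host trees -/

section HostTree

variable {V : Type u} {G : SimpleGraph V} {A : Set V} {H : SimpleGraph A}

/-- The graph `H` is a tree on the side `A` of the bipartite graph `G` such that neighbourhoods of
vertices outside of `A` are connected in `H`. -/
structure IsHostTree (G : SimpleGraph V) (A : Set V) (H : SimpleGraph A) : Prop where
  cross : ∀ x y, G.Adj x y → (x ∈ A ↔ y ∉ A)
  isTree : H.IsTree
  preconnected : ∀ b ∉ A, (H.induce {a : A | G.Adj b a}).Preconnected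

lemma IsTreeConvex.exists_isHostTree {t Δ : ℕ} (hG : IsTreeConvex t Δ G) :
    ∃ (A : Set V) (H : SimpleGraph A), IsBoundedTree t Δ H ∧ IsHostTree G A H := by
  obtain ⟨A, B, hAB, hbip, H, hH, hconn⟩ := hG
  have hdisj := Set.disjoint_left.1 hbip.disjoint
  refine ⟨A, H, hH, fun x y hxy => ?_, hH.isTree, fun b hb =>
    hconn b ((hAB.symm ▸ Set.mem_univ b : b ∈ A ∪ B).resolve_left hb)⟩
  rcases hbip.mem_of_adj hxy with ⟨hx, hy⟩ | ⟨hx, hy⟩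
  · exact ⟨fun _ hyA => hdisj hyA hy, fun _ => hx⟩
  · exact ⟨fun hxA => absurd hx (hdisj hxA), fun hyA => absurd hy hyA⟩

namespace IsHostTree

variable (hH : IsHostTree G A H)
include hH

lemma reducible [Finite A] [DecidableEq V] {r : A} {p : A → A} {d : A → ℕ}
    (h : IsRooted H r p d) {X : Finset A} {a : A} (hmax : ∀ x ∈ X, d x ≤ d a) :
    Reducible G (X.image Subtype.val) a (p a) := by
  classical
  rintro b hba ⟨x, hx, hxa, hbx⟩
  obtain ⟨x, hxX, rfl⟩ := Finset.mem_image.1 hx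
  have hbA : b ∉ A := (hH.cross a b hba.symm).1 a.2
  obtain ⟨τ, hτ, hmin⟩ := Set.exists_min_image {a : A | G.Adj b a} d (Set.toFinite _) ⟨a, hba⟩
  have parent_mem {y : A} := h.parent_mem (hH.preconnected b hbA) (x := y) hτ hmin
  by_cases haτ : a = τ
  · subst haτ
    obtain ⟨hxr, hpx⟩ := parent_mem hbx fun he => hxa (by rw [he])
    have := h.lt x hxr
    have := hmin _ hpx
    have := hmax x hxX
    omega
  · exact (parent_mem hba haτ).2

lemma dismantlable_image [Finite A] [DecidableEq V] {r : A} {p : A → A} {d : A → ℕ}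
    (h : IsRooted H r p d) {X : Finset A} (hX : ∀ x ∈ X, x ≠ r → p x ∈ X) :
    Dismantlable G (X.image Subtype.val) := by
  induction hn : X.card generalizing X with
  | zero => exact .base (Finset.card_image_le.trans (by omega))
  | succ n ih =>
    by_cases hcard : X.card ≤ 1
    · exact .base (Finset.card_image_le.trans hcard)
    obtain ⟨a, ha, hmax⟩ := X.exists_max_image d (Finset.card_pos.1 (by omega))
    have ne_parent {x : A} (hx : x ∈ X) (hxr : x ≠ r) : a ≠ p x := fun he => by
      have := h.lt x hxr
      have := hmax x hx
      subst he
      omega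
    have har : a ≠ r := by
      rintro rfl
      obtain ⟨x, hx, hxa⟩ := Finset.exists_mem_ne (not_le.1 hcard) a
      have := hmax x hx
      have := h.lt x hxa
      have := h.root
      omega
    refine .step (Finset.mem_image_of_mem _ ha) (Finset.mem_image_of_mem _ (hX a ha har))
      (Subtype.coe_injective.ne (ne_parent ha har)) (hH.reducible h hmax) ?_
    rw [← Finset.image_erase Subtype.val_injective]
    refine ih (fun x hx hxr => ?_) (by rw [Finset.card_erase_of_mem ha]; omega)
    have hxX := Finset.mem_of_mem_erase hx
    exact Finset.mem_erase.2 ⟨(ne_parent hxX hxr).symm, hX x hxX hxr⟩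

lemma adj_of_isAncestor {r : A} {p : A → A} {d : A → ℕ} (h : IsRooted H r p d) {x y : A}
    (hxy : IsAncestor r p x y) {b : V} (hbr : G.Adj b r) (hbx : G.Adj b x) : G.Adj b y := by
  have hbA : b ∉ A := (hH.cross r b hbr.symm).1 r.2
  induction hxy with
  | refl => exact hbx
  | @tail a c _ hac ih =>
    rw [← hac.2]
    exact (h.parent_mem (S := {a : A | G.Adj b a}) (hH.preconnected b hbA) hbr
      (fun y _ => h.root ▸ Nat.zero_le _) ih hac.1).2

lemma traceWidthLE [Finite A] {t Δ : ℕ} (hΔ : ∀ w, deg H w ≤ Δ)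
    (ht : {w | 3 ≤ deg H w}.encard ≤ t) {r : V} (hr : r ∈ A) :
    TraceWidthLE G (t * Δ + 2) r := by
  classical
  intro K hK
  by_cases hcard : K.card ≤ 1
  · omega
  have exists_ne (x : V) := Finset.exists_mem_ne (not_le.1 hcard) x
  obtain ⟨p, d, h⟩ := exists_isRooted hH.isTree ⟨r, hr⟩
  have subset_side (x : V) (hx : x ∈ K) : x ∈ A := by
    obtain ⟨y, hy, hyx⟩ := exists_ne x
    obtain ⟨b, hrb, hbx, -⟩ := hK x hx y hy hyx.symm
    exact (hH.cross x b hbx.symm).2 ((hH.cross r b hrb).1 hr)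
  have root_notMem : r ∉ K := fun hrK => by
    obtain ⟨y, hy, hyr⟩ := exists_ne r
    obtain ⟨b, hrb, -, hbr⟩ := hK y hy r hrK hyr
    exact hbr hrb.symm
  rw [← Finset.filter_true_of_mem subset_side, ← Finset.card_subtype]
  refine h.card_le_of_incomparable hΔ ht (by simpa using root_notMem) fun x hx y hy hxy hanc => ?_
  rw [Finset.mem_subtype] at hx hy
  obtain ⟨b, hrb, hbx, hby⟩ := hK x hx y hy (Subtype.coe_injective.ne hxy)
  exact hby (hH.adj_of_isAncestor h hanc hrb.symm hbx)

end IsHostTree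

theorem IsTreeConvex.exists_isGoodSide [Fintype V] [DecidableEq V] {t Δ : ℕ}
    (hG : IsTreeConvex t Δ G) :
    ∃ A : Finset V, A.Nonempty ∧ IsGoodSide G (t * Δ + 2) A Finset.univ := by
  classical
  obtain ⟨A, H, hbdd, hH⟩ := hG.exists_isHostTree
  obtain ⟨r⟩ := hbdd.isTree.connected.nonempty
  obtain ⟨p, d, h⟩ := exists_isRooted hbdd.isTree r
  refine ⟨A.toFinset, ⟨r, by simp⟩, ⟨fun _ _ _ _ => Finset.mem_univ _, fun x _ y hxy => ?_⟩,
    Finset.subset_univ _, ?_, fun r hr =>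
      hH.traceWidthLE hbdd.deg_le hbdd.branching_le (Set.mem_toFinset.1 hr)⟩
  · simpa using hH.cross x y hxy
  · have hd := hH.dismantlable_image h (X := Finset.univ) fun _ _ _ => Finset.mem_univ _
    convert hd
    ext x
    simp

lemma le_mimBound {t Δ : ℕ} (hΔ : 3 ≤ Δ) : t * Δ + 2 ≤ mimBound t Δ := by
  unfold mimBound
  have := Nat.mul_le_mul_right Δ (Nat.le_self_pow two_ne_zero t)
  have := le_max_right (2 * ⌊((Δ : ℚ) / 2) ^ 2⌋₊) (2 * Δ - 1)
  omega

end HostTree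

/-! ### The forest built by the merging process -/

section Forest

variable {n k c : ℕ} {G : SimpleGraph (Fin n)} {A R : Finset (Fin n)} {par cur : ℕ → ℕ}
  {rep : Fin n → Fin n} {cl : ℕ → Set (Fin n)} {u v : Fin n}

/-- The numbers less than `c` are the nodes of a binary forest with leaves `0, …, n - 1` and parent
function `par`, whose roots are the numbers `cur v` for the remaining vertices `v`. The parent of a
root is `2 * n`, which never becomes a node. -/
structure IsForest (R : Finset (Fin n)) (par cur : ℕ → ℕ) (c : ℕ) : Prop where
  count : c + R.card = 2 * n
  cur_lt : ∀ v ∈ R, cur v < c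
  cur_inj : ∀ v ∈ R, ∀ w ∈ R, cur v = cur w → v = w
  par_cur : ∀ v ∈ R, par (cur v) = 2 * n
  par_mem : ∀ y < c, (∃ v ∈ R, cur v = y) ∨ y < par y ∧ n ≤ par y ∧ par y < c
  two : ∀ d, n ≤ d → d < c → ∃ y z, y ≠ z ∧ y < c ∧ z < c ∧ ∀ w < c, par w = d ↔ w = y ∨ w = z

/-- The parent function after the roots `y` and `z` have become the children of a new root `c`. -/
def attach (n : ℕ) (par : ℕ → ℕ) (y z c : ℕ) : ℕ → ℕ :=
  Function.update (Function.update (Function.update par y c) z c) c (2 * n)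

lemma isForest_univ (hpar : ∀ v < n, par v = 2 * n) (hcur : ∀ v < n, cur v = v) :
    IsForest (Finset.univ : Finset (Fin n)) par cur n where
  count := by simp [two_mul]
  cur_lt v _ := (hcur v v.2).trans_lt v.2
  cur_inj v _ w _ h := by rwa [hcur v v.2, hcur w w.2, ← Fin.ext_iff] at h
  par_cur v _ := by rw [hcur v v.2, hpar v v.2]
  par_mem y hy := .inl ⟨⟨y, hy⟩, Finset.mem_univ _, hcur y hy⟩
  two d hd hd' := absurd hd hd'.not_ge

namespace IsForest

lemma le (h : IsForest R par cur c) : n ≤ c := by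
  have := h.count
  have := R.card_le_univ.trans_eq (Fintype.card_fin n)
  omega

section Merge

variable (h : IsForest R par cur c) (hu : u ∈ R) (hv : v ∈ R) (huv : u ≠ v)
include h hu hv huv

lemma add_two_le : c + 2 ≤ 2 * n := by
  have := h.count
  have : 1 < R.card := Finset.one_lt_card.2 ⟨u, hu, v, hv, huv⟩
  omega

lemma attach_self {w : ℕ} (hw : w < c + 1) :
    attach n par (cur u) (cur v) c w = c ↔ w = cur u ∨ w = cur v := by
  have := h.add_two_le hu hv huv
  have := h.cur_lt u hu
  have := h.cur_lt v hv
  have par_ne (hwc : w < c) : par w ≠ c := by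
    rcases h.par_mem w hwc with ⟨x, hx, rfl⟩ | hpar
    · rw [h.par_cur x hx]
      omega
    · omega
  simp only [attach, Function.update_apply]
  split_ifs <;> simp_all <;> omega

lemma attach_of_lt {w d : ℕ} (hd : d < c) :
    w < c + 1 ∧ attach n par (cur u) (cur v) c w = d ↔ w < c ∧ par w = d := by
  have := h.add_two_le hu hv huv
  have := h.cur_lt u hu
  have := h.cur_lt v hv
  have := h.par_cur u hu
  have := h.par_cur v hv
  simp only [attach, Function.update_apply]
  split_ifs <;> simp_all <;> omega

omit huv in
lemma attach_cur_of_ne {w : Fin n} (hw : w ∈ R) (hwu : w ≠ u) (hwv : w ≠ v) :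
    attach n par (cur u) (cur v) c (cur w) = 2 * n := by
  have hne {x : Fin n} (hx : x ∈ R) (hwx : w ≠ x) : cur w ≠ cur x := mt (h.cur_inj w hw x hx) hwx
  rw [attach, Function.update_of_ne (h.cur_lt w hw).ne, Function.update_of_ne (hne hv hwv),
    Function.update_of_ne (hne hu hwu), h.par_cur w hw]

lemma two_attach {d : ℕ} (hd : n ≤ d) (hdc : d < c + 1) :
    ∃ y z, y ≠ z ∧ y < c + 1 ∧ z < c + 1 ∧
      ∀ w < c + 1, attach n par (cur u) (cur v) c w = d ↔ w = y ∨ w = z := by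
  rcases (Nat.lt_succ_iff.1 hdc).lt_or_eq with hdc | rfl
  · obtain ⟨y, z, hyz, hy, hz, hchildren⟩ := h.two d hd hdc
    refine ⟨y, z, hyz, by omega, by omega, fun w hw => ?_⟩
    have := h.attach_of_lt hu hv huv (w := w) hdc
    have := hchildren w
    grind
  · exact ⟨cur u, cur v, mt (h.cur_inj u hu v hv) huv, (h.cur_lt u hu).trans (Nat.lt_succ_self _),
      (h.cur_lt v hv).trans (Nat.lt_succ_self _), fun w hw => h.attach_self hu hv huv hw⟩

lemma attach_mem {y : ℕ} (hy : y < c) :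
    (∃ w ∈ R, w ≠ u ∧ w ≠ v ∧ cur w = y) ∨
      y < attach n par (cur u) (cur v) c y ∧ n ≤ attach n par (cur u) (cur v) c y ∧
        attach n par (cur u) (cur v) c y < c + 1 := by
  have := h.add_two_le hu hv huv
  have := h.le
  by_cases hchild : y = cur u ∨ y = cur v
  · rw [(h.attach_self hu hv huv (by omega)).2 hchild]
    omega
  · rcases h.par_mem y hy with ⟨w, hw, rfl⟩ | hpar
    · exact .inl ⟨w, hw, fun he => hchild (.inl (he ▸ rfl)), fun he => hchild (.inr (he ▸ rfl)),
        rfl⟩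
    · have := ((h.attach_of_lt hu hv huv hpar.2.2).2 ⟨hy, rfl⟩).2
      omega

lemma merge : IsForest (R.erase u) (attach n par (cur u) (cur v) c) (Function.update cur v c)
    (c + 1) := by
  have old {w : Fin n} (hw : w ≠ v) : Function.update cur v c w = cur w :=
    Function.update_of_ne (Fin.val_injective.ne hw) _ _
  have cur_lt {w : Fin n} (hw : w ∈ R.erase u) : cur w < c :=
    h.cur_lt w (Finset.mem_of_mem_erase hw)
  refine ⟨?_, fun w hw => ?_, fun w hw x hx heq => ?_, fun w hw => ?_, fun y hy => ?_,
    fun d hd hdc => h.two_attach hu hv huv hd hdc⟩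
  · have := h.count
    have := Finset.card_erase_add_one hu
    omega
  · rcases eq_or_ne w v with rfl | hwv
    · simp
    · exact (old hwv).trans_lt ((cur_lt hw).trans c.lt_succ_self)
  · have := cur_lt hw
    have := cur_lt hx
    have := h.cur_inj w (Finset.mem_of_mem_erase hw) x (Finset.mem_of_mem_erase hx)
    grind
  · obtain ⟨hwu, hwR⟩ := Finset.mem_erase.1 hw
    rcases eq_or_ne w v with rfl | hwv
    · simp [attach]
    · rw [old hwv, h.attach_cur_of_ne hu hv hwR hwu hwv]
  · rcases (Nat.lt_succ_iff.1 hy).lt_or_eq with hyc | rfl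
    · exact (h.attach_mem hu hv huv hyc).imp_left fun ⟨w, hw, hwu, hwv, hwy⟩ =>
        ⟨w, Finset.mem_erase.2 ⟨hwu, hw⟩, (old hwv).trans hwy⟩
    · exact .inl ⟨v, Finset.mem_erase.2 ⟨huv.symm, hv⟩, Function.update_self ..⟩

end Merge

lemma cur_eq_of_card_eq_one (h : IsForest R par cur c) (hv : R = {v}) :
    c = 2 * n - 1 ∧ cur v = 2 * n - 2 := by
  subst hv
  have hcount : c + 1 = 2 * n := h.count
  have := v.pos
  refine ⟨by omega, ?_⟩
  rcases h.par_mem (2 * n - 2) (by omega) with ⟨w, hw, hcur⟩ | hpar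
  · rwa [Finset.mem_singleton.1 hw] at hcur
  · omega

lemma isParentMap (h : IsForest R par cur c) (hR : R.card = 1) : IsParentMap n c par := by
  obtain ⟨v, hv⟩ := Finset.card_eq_one.1 hR
  obtain ⟨hc, hlast⟩ := h.cur_eq_of_card_eq_one hv
  subst hv
  have hroot := h.par_cur v (Finset.mem_singleton_self v)
  have := v.pos
  have par_mem (y : ℕ) (hy : y < c) : y = cur v ∨ y < par y ∧ n ≤ par y ∧ par y < c :=
    (h.par_mem y hy).imp_left fun ⟨w, hw, hwy⟩ => by rw [← hwy, Finset.mem_singleton.1 hw]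
  refine ⟨this, by omega, fun x hx => ?_, fun x hx => ?_, fun x hx => ?_, h.two⟩ <;>
    rcases par_mem x (by omega) with rfl | hpar <;> omega

end IsForest

/-- The set `cl y` consists of the leaves below the node `y` of a forest. Below a root `cur v` these
are the vertices merged into `v`, and all of these sets induce cuts of mim-width at most `k`. -/
structure IsLabelling (G : SimpleGraph (Fin n)) (k : ℕ) (R : Finset (Fin n)) (par cur : ℕ → ℕ)
    (c : ℕ) (rep : Fin n → Fin n) (cl : ℕ → Set (Fin n)) : Prop where
  leaf : ∀ v : Fin n, cl v = {v}
  node : ∀ d, n ≤ d → d < c → ∀ x, x ∈ cl d ↔ ∃ w < c, par w = d ∧ x ∈ cl w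
  root : ∀ v ∈ R, cl (cur v) = {x | rep x = v}
  cut : ∀ y < c, cutMim G (cl y) ≤ k

lemma isLabelling_id (hk : 1 ≤ k) (hcur : ∀ v < n, cur v = v) :
    IsLabelling G k Finset.univ par cur n id fun y => {x | (x : ℕ) = y} := by
  refine ⟨fun v => Set.ext fun _ => Fin.ext_iff.symm, fun d hd hd' => absurd hd hd'.not_ge,
    fun v _ => Set.ext fun x => ?_, fun y hy => ?_⟩
  · rw [Set.mem_ofPred_eq, hcur v v.2]
    exact Fin.ext_iff.symm
  · have hcut : cutMim G {x | (x : ℕ) = y} ≤ 1 :=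
      cutMim_le_one (v := ⟨y, hy⟩) fun x (hx : (x : ℕ) = y) _ _ _ => Fin.ext hx
    exact hcut.trans (by exact_mod_cast hk)

lemma IsLabelling.node_attach (h : IsLabelling G k R par cur c rep cl) (hF : IsForest R par cur c)
    (hu : u ∈ R) (hv : v ∈ R) (huv : u ≠ v) {d : ℕ} (hd : n ≤ d) (hdc : d < c + 1) (x : Fin n) :
    x ∈ Function.update cl c (cl (cur u) ∪ cl (cur v)) d ↔
      ∃ w < c + 1, attach n par (cur u) (cur v) c w = d ∧
        x ∈ Function.update cl c (cl (cur u) ∪ cl (cur v)) w := by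
  have old {y : ℕ} (hy : y < c) : Function.update cl c (cl (cur u) ∪ cl (cur v)) y = cl y :=
    Function.update_of_ne hy.ne _ _
  have hcu := hF.cur_lt u hu
  have hcv := hF.cur_lt v hv
  rcases (Nat.lt_succ_iff.1 hdc).lt_or_eq with hdc | rfl
  · rw [old hdc, h.node d hd hdc]
    refine exists_congr fun w => ?_
    rw [← and_assoc, ← and_assoc, hF.attach_of_lt hu hv huv hdc]
    exact and_congr_right fun hw => by rw [old hw.1]
  · rw [Function.update_self]
    constructor
    · rintro (hx | hx)
      · exact ⟨cur u, by omega, (hF.attach_self hu hv huv (by omega)).2 (.inl rfl),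
          by rwa [old hcu]⟩
      · exact ⟨cur v, by omega, (hF.attach_self hu hv huv (by omega)).2 (.inr rfl),
          by rwa [old hcv]⟩
    · rintro ⟨w, hw, hwd, hx⟩
      rcases (hF.attach_self hu hv huv hw).1 hwd with rfl | rfl
      · exact .inl (by rwa [old hcu] at hx)
      · exact .inr (by rwa [old hcv] at hx)

lemma IsLabelling.merge (h : IsLabelling G k R par cur c rep cl) (hF : IsForest R par cur c)
    (hu : u ∈ R) (hv : v ∈ R) (huv : u ≠ v)
    (hcut : cutMim G {x | (if rep x = u then v else rep x) = v} ≤ k) :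
    IsLabelling G k (R.erase u) (attach n par (cur u) (cur v) c) (Function.update cur v c) (c + 1)
      (fun x => if rep x = u then v else rep x)
      (Function.update cl c (cl (cur u) ∪ cl (cur v))) := by
  have old {y : ℕ} (hy : y < c) : Function.update cl c (cl (cur u) ∪ cl (cur v)) y = cl y :=
    Function.update_of_ne hy.ne _ _
  have new : cl (cur u) ∪ cl (cur v) = {x | (if rep x = u then v else rep x) = v} := by
    rw [h.root u hu, h.root v hv]
    ext x
    by_cases hx : rep x = u <;> simp [hx]
  refine ⟨fun w => ?_, fun d hd hdc => h.node_attach hF hu hv huv hd hdc, fun w hw => ?_,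
    fun y hy => ?_⟩
  · rw [old (w.2.trans_le hF.le), h.leaf]
  · obtain ⟨hwu, hwR⟩ := Finset.mem_erase.1 hw
    rcases eq_or_ne w v with rfl | hwv
    · rw [Function.update_self, Function.update_self, new]
    · rw [Function.update_of_ne (Fin.val_injective.ne hwv), old (hF.cur_lt w hwR), h.root w hwR]
      ext x
      by_cases hx : rep x = u <;> simp [hx, hwu.symm, hwv.symm]
  · rcases (Nat.lt_succ_iff.1 hy).lt_or_eq with hyc | rfl
    · rw [old hyc]
      exact h.cut y hyc
    · rwa [Function.update_self, new]

/-- The merging process has built a forest that displays its clusters. -/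
def ForestInv (G : SimpleGraph (Fin n)) (k : ℕ) (A R : Finset (Fin n)) (par cur : ℕ → ℕ)
    (c : ℕ) : Prop :=
  IsForest R par cur c ∧
    ∃ rep cl, ClusterInv G A R rep ∧ IsLabelling G k R par cur c rep cl

lemma forestInv_univ (hk : 1 ≤ k) (hpar : ∀ v < n, par v = 2 * n) (hcur : ∀ v < n, cur v = v) :
    ForestInv G k A Finset.univ par cur n :=
  ⟨isForest_univ hpar hcur, _, _, clusterInv_id A, isLabelling_id hk hcur⟩

lemma ForestInv.merge (h : ForestInv G k A R par cur c) (hk : 1 ≤ k)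
    (hA : IsSide G A Finset.univ) (hw : ∀ v ∈ A, TraceWidthLE G k v) (huv : CanMerge G A R u v) :
    ForestInv G k A (R.erase u) (attach n par (cur u) (cur v) c) (Function.update cur v c)
      (c + 1) := by
  obtain ⟨hF, rep, cl, hrep, hcl⟩ := h
  exact ⟨hF.merge huv.left huv.right huv.ne, _, _, hrep.merge huv,
    hcl.merge hF huv.left huv.right huv.ne ((hrep.merge huv).cutMim_le hA hk (hw v))⟩

lemma ForestInv.exists_mimw_le (h : ForestInv G k A R par cur c) (hR : R.card = 1) :
    ∃ hp : IsParentMap n c par, hp.toBranchDecomposition.mimw G ≤ k := by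
  obtain ⟨hF, rep, cl, -, hcl⟩ := h
  exact ⟨hF.isParentMap hR, (hF.isParentMap hR).mimw_le hcl.leaf hcl.node hcl.cut⟩

end Forest

/-! ### Bounded Hoare triples -/

/-- A Hoare triple for total correctness, with a bound `C` on the number of steps. -/
def Triple (P : State → Prop) (p : Prog) (C : ℕ) (Q : State → Prop) : Prop :=
  ∀ s, P s → ∃ s' k, Exec p s s' k ∧ k ≤ C ∧ Q s'

namespace Triple

variable {P Q Q' R : State → Prop} {p q : Prog} {e : Expr} {C C' : ℕ}

lemma mono (h : Triple P p C Q) (hC : C ≤ C') (hQ : ∀ s, Q s → Q' s) : Triple P p C' Q' :=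
  fun s hs =>
    let ⟨s', k, hk, hkC, hs'⟩ := h s hs
    ⟨s', k, hk, hkC.trans hC, hQ s' hs'⟩

lemma assign {x : ℕ}
    (h : ∀ s, P s → Q { s with reg := Function.update s.reg x (e.eval s) }) :
    Triple P (.assign x e) (e.cost + 1) Q :=
  fun s hs => ⟨_, _, .assign s x e, le_rfl, h s hs⟩

lemma seq (hp : Triple P p C Q) (hq : Triple Q q C' R) : Triple P (.seq p q) (C + C') R :=
  fun s hs =>
    let ⟨_, _, hk, hkC, hs'⟩ := hp s hs
    let ⟨s'', _, hl, hlC, hs''⟩ := hq _ hs'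
    ⟨s'', _, .seq hk hl, Nat.add_le_add hkC hlC, hs''⟩

lemma cond (hp : Triple (fun s => P s ∧ e.eval s ≠ 0) p C Q)
    (hq : Triple (fun s => P s ∧ e.eval s = 0) q C' Q) :
    Triple P (.cond e p q) (e.cost + 1 + C + C') Q := by
  intro s hs
  by_cases he : e.eval s = 0
  · obtain ⟨s', k, hk, hkC, hs'⟩ := hq s ⟨hs, he⟩
    exact ⟨s', _, .cond_false he hk, by omega, hs'⟩
  · obtain ⟨s', k, hk, hkC, hs'⟩ := hp s ⟨hs, he⟩
    exact ⟨s', _, .cond_true he hk, by omega, hs'⟩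

lemma loop {n : ℕ} (I : ℕ → State → Prop) (body : ∀ i < n, Triple (I i) p C (I (i + 1)))
    (continues : ∀ i < n, ∀ s, I i s → e.eval s ≠ 0) (halts : ∀ s, I n s → e.eval s = 0) :
    Triple (I 0) (.loop e p) (n * (C + e.cost + 1) + (e.cost + 1)) (I n) := by
  suffices H : ∀ d i, i + d = n →
      Triple (I i) (.loop e p) (d * (C + e.cost + 1) + (e.cost + 1)) (I n) from
    H n 0 (Nat.zero_add n)
  intro d
  induction d with
  | zero =>
    rintro i rfl s hs
    exact ⟨s, _, .loop_false (halts s hs), by omega, hs⟩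
  | succ d ih =>
    intro i hi s hs
    obtain ⟨s', k, hk, hkC, hs'⟩ := body i (by omega) s hs
    obtain ⟨s'', l, hl, hlC, hs''⟩ := ih (i + 1) (by omega) s' hs'
    refine ⟨s'', _, .loop_true (continues i (by omega) s hs) hk hl, ?_, hs''⟩
    rw [Nat.add_mul]
    omega

end Triple

/-! ### A language of bounded loops -/

/-- The contents of the arrays. -/
abbrev Arrays := ℕ → ℕ → ℕ

/-- Expressions with bounded sums. All sums range over the numbers less than a fixed number `n`,
the value of `len`. -/
inductive LExpr where
  | const (c : ℕ)
  | len
  | var (x : ℕ)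
  | read (a : ℕ) (i : LExpr)
  | add (e f : LExpr)
  | sub (e f : LExpr)
  | sum (x : ℕ) (e : LExpr)

/-- The value of an expression, given `n`, the arrays and the values of the variables. -/
def LExpr.eval (n : ℕ) (α : Arrays) : (ℕ → ℕ) → LExpr → ℕ
  | _, .const c => c
  | _, .len => n
  | ρ, .var x => ρ x
  | ρ, .read a i => α a (i.eval n α ρ)
  | ρ, .add e f => e.eval n α ρ + f.eval n α ρ
  | ρ, .sub e f => e.eval n α ρ - f.eval n α ρ
  | ρ, .sum x e => ∑ i ∈ Finset.range n, e.eval n α (Function.update ρ x i)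

/-- Commands with loops over the numbers less than `n`. Loop variables are lexically scoped, so
that only the arrays are changed by a command. -/
inductive Cmd where
  | skip
  | write (a : ℕ) (i e : LExpr)
  | seq (p q : Cmd)
  | ite (e : LExpr) (p q : Cmd)
  | loop (x : ℕ) (p : Cmd)

/-- The composition of `f 0, …, f (n - 1)`. -/
def iter {S : Type*} (f : ℕ → S → S) : ℕ → S → S
  | 0, s => s
  | n + 1, s => f n (iter f n s)

/-- Replace the entry `i` of the array `a` by `v`. -/
def Arrays.set (α : Arrays) (a i v : ℕ) : Arrays :=
  Function.update α a (Function.update (α a) i v)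

/-- The meaning of a command, as a function of the arrays. -/
def Cmd.den (n : ℕ) : Cmd → (ℕ → ℕ) → Arrays → Arrays
  | .skip, _, α => α
  | .write a i e, ρ, α => α.set a (i.eval n α ρ) (e.eval n α ρ)
  | .seq p q, ρ, α => q.den n ρ (p.den n ρ α)
  | .ite e p q, ρ, α => if e.eval n α ρ ≠ 0 then p.den n ρ α else q.den n ρ α
  | .loop x p, ρ, α => iter (fun i α => p.den n (Function.update ρ x i) α) n α

/-! ### Compilation -/

/-- The register of a variable. -/
def vreg (x : ℕ) : ℕ := 2 * x + 2

/-- The register of a temporary. -/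
def treg (t : ℕ) : ℕ := 2 * t + 1

@[simp] lemma treg_inj {t u : ℕ} : treg t = treg u ↔ t = u := by unfold treg; omega
@[simp] lemma vreg_inj {x y : ℕ} : vreg x = vreg y ↔ x = y := by unfold vreg; omega
@[simp] lemma vreg_ne_treg {x t : ℕ} : vreg x ≠ treg t := by unfold treg vreg; omega
@[simp] lemma treg_ne_vreg {t x : ℕ} : treg t ≠ vreg x := by unfold treg vreg; omega
@[simp] lemma zero_ne_treg {t : ℕ} : 0 ≠ treg t := by unfold treg; omega
@[simp] lemma zero_ne_vreg {x : ℕ} : 0 ≠ vreg x := by unfold vreg; omega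

/-- A loop that runs through the values of the variable `x`. The temporary `t` counts the rounds
and the temporary `t + 1` saves the value that `x` has outside the loop. -/
def forLoop (t x : ℕ) (p : Prog) : Prog :=
  .seq (.assign (treg t) (.const 0)) <|
  .seq (.assign (treg (t + 1)) (.reg (vreg x))) <|
  .seq (.loop (.sub (.reg 0) (.reg (treg t))) <|
    .seq (.assign (vreg x) (.reg (treg t))) <|
    .seq p <| .assign (treg t) (.add (.reg (treg t)) (.const 1))) <|
  .assign (vreg x) (.reg (treg (t + 1)))

/-- A program that computes the value of an expression into the temporary `t`. -/
def LExpr.code : LExpr → ℕ → Prog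
  | .const c, t => .assign (treg t) (.const c)
  | .len, t => .assign (treg t) (.reg 0)
  | .var x, t => .assign (treg t) (.reg (vreg x))
  | .read a i, t => .seq (i.code t) (.assign (treg t) (.read a (.reg (treg t))))
  | .add e f, t => .seq (e.code t) <| .seq (f.code (t + 1)) <|
      .assign (treg t) (.add (.reg (treg t)) (.reg (treg (t + 1))))
  | .sub e f, t => .seq (e.code t) <| .seq (f.code (t + 1)) <|
      .assign (treg t) (.sub (.reg (treg t)) (.reg (treg (t + 1))))
  | .sum x e, t => .seq (.assign (treg t) (.const 0)) <|
      forLoop (t + 1) x <| .seq (e.code (t + 3)) <|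
        .assign (treg t) (.add (.reg (treg t)) (.reg (treg (t + 3))))

/-- The program of a command, with temporaries from `t` on. -/
def Cmd.code : Cmd → ℕ → Prog
  | .skip, _ => .skip
  | .write a i e, t => .seq (i.code t) <| .seq (e.code (t + 1)) <|
      .write a (.reg (treg t)) (.reg (treg (t + 1)))
  | .seq p q, t => .seq (p.code t) (q.code t)
  | .ite e p q, t => .seq (e.code t) (.cond (.reg (treg t)) (p.code t) (q.code t))
  | .loop x p, t => forLoop t x (p.code (t + 2))

/-- The state `s` holds the number `n`, the temporaries `τ u` with `u < t`, the variables `ρ` and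
the arrays `α`. -/
structure Represents (n t : ℕ) (τ ρ : ℕ → ℕ) (α : Arrays) (s : State) : Prop where
  len : s.reg 0 = n
  temp : ∀ u < t, s.reg (treg u) = τ u
  var : ∀ x, s.reg (vreg x) = ρ x
  arr : s.arr = α

section Compilation

variable {n t t' u x C : ℕ} {τ τ' ρ : ℕ → ℕ} {α : Arrays} {e : Expr}

lemma Represents.mono {s : State} (h : Represents n t τ ρ α s)
    (hτ : ∀ u < t', u < t ∧ τ' u = τ u) : Represents n t' τ' ρ α s where
  len := h.len
  temp u hu := (h.temp u (hτ u hu).1).trans (hτ u hu).2.symm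
  var := h.var
  arr := h.arr

lemma triple_assign_treg {v : ℕ} (he : ∀ s, Represents n t τ ρ α s → e.eval s = v)
    (hτ : ∀ w < t', w = u ∧ τ' w = v ∨ w ≠ u ∧ w < t ∧ τ' w = τ w) :
    Triple (Represents n t τ ρ α) (.assign (treg u) e) (e.cost + 1)
      (Represents n t' τ' ρ α) :=
  Triple.assign fun s hs =>
    { len := by simp [hs.len]
      temp := fun w hw => by
        obtain ⟨rfl, hv⟩ | ⟨hwu, hwt, hv⟩ := hτ w hw
        · simp [he s hs, hv]
        · simp [hwu, hs.temp w hwt, hv]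
      var := fun y => by simp [hs.var]
      arr := hs.arr }

lemma triple_assign_vreg {v : ℕ} {ρ' : ℕ → ℕ}
    (he : ∀ s, Represents n t τ ρ α s → e.eval s = v) (hρ : Function.update ρ x v = ρ') :
    Triple (Represents n t τ ρ α) (.assign (vreg x) e) (e.cost + 1) (Represents n t τ ρ' α) :=
  Triple.assign fun s hs =>
    { len := by simp [hs.len]
      temp := fun w hw => by simp [hs.temp w hw]
      var := fun y => by simp [← hρ, Function.update_apply, hs.var, he s hs]
      arr := hs.arr }

lemma triple_forLoop {p : Prog} (σ : ℕ → ℕ → ℕ) (β : ℕ → Arrays)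
    (body : ∀ i < n, ∀ c, Triple
      (Represents n (t + 2) (Function.update (Function.update (σ i) t i) (t + 1) c)
        (Function.update ρ x i) (β i)) p C
      (Represents n (t + 2) (Function.update (Function.update (σ (i + 1)) t i) (t + 1) c)
        (Function.update ρ x i) (β (i + 1)))) :
    Triple (Represents n t (σ 0) ρ (β 0)) (forLoop t x p) (n * (C + 10) + 10)
      (Represents n t (σ n) ρ (β n)) := by
  let temps (i j : ℕ) := Function.update (Function.update (σ i) t j) (t + 1) (ρ x)
  let I (i : ℕ) (s : State) := ∃ v, Represents n (t + 2) (temps i i) (Function.update ρ x v) (β i) s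
  have round : ∀ i < n, Triple (I i) (.seq (.assign (vreg x) (.reg (treg t))) <|
      .seq p <| .assign (treg t) (.add (.reg (treg t)) (.const 1))) (2 + (C + 4)) (I (i + 1)) := by
    rintro i hi s ⟨v, hs⟩
    refine Triple.mono (.seq
      (triple_assign_vreg (v := i) (fun s hs => ?_) (Function.update_idem v i ρ))
      (.seq (body i hi (ρ x)) (triple_assign_treg (v := i + 1) (τ' := temps (i + 1) (i + 1))
        (fun s hs => ?_) fun w hw => ?_))) ?_ (fun s hs => ⟨i, hs⟩) s hs
    · simp [Expr.eval, hs.temp t]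
    · simp [Expr.eval, hs.temp t]
    · by_cases h : w = t <;> by_cases h' : w = t + 1 <;> simp_all [temps]
    · simp [Expr.cost]
  have exit : Triple (I n) (.assign (vreg x) (.reg (treg (t + 1)))) 2
      (Represents n t (σ n) ρ (β n)) := by
    rintro s ⟨v, hs⟩
    refine (triple_assign_vreg (v := ρ x) (fun s hs => ?_) ?_).mono le_rfl
      (fun s hs => hs.mono fun u hu => ⟨?_, ?_⟩) s hs
    · simp [Expr.eval, hs.temp (t + 1), temps]
    · rw [Function.update_idem, Function.update_eq_self]
    · omega
    · simp [temps, show u ≠ t by omega, show u ≠ t + 1 by omega]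
  have rounds := Triple.loop (e := .sub (.reg 0) (.reg (treg t))) I round
    (fun i hi s ⟨v, hs⟩ => by simp [Expr.eval, hs.len, hs.temp t, temps]; omega)
    (fun s ⟨v, hs⟩ => by simp [Expr.eval, hs.len, hs.temp t, temps])
  refine Triple.mono (.seq (triple_assign_treg (v := 0) (t' := t + 1)
      (τ' := Function.update (σ 0) t 0) (fun s _ => rfl) fun w hw => ?_)
    (.seq (triple_assign_treg (v := ρ x) (t' := t + 2) (τ' := temps 0 0)
        (fun s hs => hs.var x) fun w hw => ?_)
      (.seq (fun s hs => rounds s ⟨ρ x, by simpa using hs⟩) exit))) ?_ fun s hs => hs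
  · by_cases h : w = t <;> simp [h]; omega
  · by_cases h : w = t + 1 <;> simp [temps, h]; omega
  · simp only [Expr.cost]
    nlinarith

lemma triple_assign_result {v : ℕ} (he : ∀ s, Represents n t' τ' ρ α s → e.eval s = v)
    (ht : t ≤ t') (hτ : ∀ w < t, τ w = τ' w) :
    Triple (Represents n t' τ' ρ α) (.assign (treg t) e) (e.cost + 1)
      (Represents n (t + 1) (Function.update τ t v) ρ α) :=
  triple_assign_treg he fun w hw => by
    by_cases h : w = t
    · simp [h]
    · simp [h, hτ w (by omega)]
      omega

lemma triple_binary {p q : Prog} {C' a b c : ℕ}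
    (hp : Triple (Represents n t τ ρ α) p C (Represents n (t + 1) (Function.update τ t a) ρ α))
    (hq : Triple (Represents n (t + 1) (Function.update τ t a) ρ α) q C'
      (Represents n (t + 2) (Function.update (Function.update τ t a) (t + 1) b) ρ α))
    (he : ∀ s : State, s.reg (treg t) = a → s.reg (treg (t + 1)) = b → e.eval s = c) :
    Triple (Represents n t τ ρ α) (.seq p (.seq q (.assign (treg t) e))) (C + (C' + (e.cost + 1)))
      (Represents n (t + 1) (Function.update τ t c) ρ α) :=
  hp.seq <| hq.seq <| triple_assign_result
    (fun s hs => he s (by simp [hs.temp t]) (by simp [hs.temp (t + 1)])) (by omega)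
    fun w hw => by simp [show w ≠ t by omega, show w ≠ t + 1 by omega]

lemma triple_sum {p : Prog} {f : ℕ → ℕ} (body : ∀ i < n, ∀ σ : ℕ → ℕ, Triple
      (Represents n (t + 3) σ (Function.update ρ x i) α) p C
      (Represents n (t + 4) (Function.update σ (t + 3) (f i)) (Function.update ρ x i) α)) :
    Triple (Represents n t τ ρ α)
      (.seq (.assign (treg t) (.const 0)) <| forLoop (t + 1) x <|
        .seq p <| .assign (treg t) (.add (.reg (treg t)) (.reg (treg (t + 3)))))
      (2 + (n * (C + 4 + 10) + 10))
      (Represents n (t + 1) (Function.update τ t (∑ j ∈ Finset.range n, f j)) ρ α) := by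
  have loop := triple_forLoop (n := n) (t := t + 1) (x := x) (ρ := ρ) (C := C + 4)
    (fun i => Function.update τ t (∑ j ∈ Finset.range i, f j)) (fun _ => α)
    fun i hi _ => (body i hi _).seq <| triple_assign_treg
      (u := t) (e := .add (.reg (treg t)) (.reg (treg (t + 3)))) (fun s hs => by
        simp only [Expr.eval, hs.temp t (by omega), hs.temp (t + 3) (by omega)]; rfl)
      fun w hw => by
        by_cases h : w = t
        · simp [h, Finset.sum_range_succ, show t ≠ t + 1 + 1 by omega]
        · simp [Function.update_apply, h]; omega
  exact (triple_assign_result (fun s _ => rfl) le_rfl fun _ _ => rfl).seq loop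

lemma LExpr.triple_code (e : LExpr) : ∃ time : Polynomial ℕ, ∀ n t τ ρ α,
    Triple (Represents n t τ ρ α) (e.code t) (time.eval n)
      (Represents n (t + 1) (Function.update τ t (e.eval n α ρ)) ρ α) := by
  induction e with
  | const c => exact ⟨2, fun n t τ ρ α => (triple_assign_result (fun s _ => rfl) le_rfl
      fun _ _ => rfl).mono (by simp [Expr.cost]) fun s hs => hs⟩
  | len => exact ⟨2, fun n t τ ρ α => (triple_assign_result (e := .reg 0) (fun s hs => hs.len)
      le_rfl fun _ _ => rfl).mono (by simp [Expr.cost]) fun s hs => hs⟩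
  | var x => exact ⟨2, fun n t τ ρ α => (triple_assign_result (e := .reg (vreg x))
      (fun s hs => hs.var x) le_rfl fun _ _ => rfl).mono (by simp [Expr.cost]) fun s hs => hs⟩
  | read a i ih =>
    obtain ⟨q, hq⟩ := ih
    exact ⟨q + 3, fun n t τ ρ α => ((hq n t τ ρ α).seq <| triple_assign_result
      (v := α a (i.eval n α ρ)) (fun s hs => by simp [Expr.eval, hs.temp t, hs.arr]) (by omega)
      fun w hw => by simp [hw.ne]).mono (by simp [Expr.cost]) fun s hs => hs⟩
  | add e f ihe ihf =>
    obtain ⟨p, hp⟩ := ihe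
    obtain ⟨q, hq⟩ := ihf
    exact ⟨p + q + 4, fun n t τ ρ α => (triple_binary (hp n t τ ρ α) (hq n (t + 1) _ ρ α)
      fun s ha hb => by simp only [Expr.eval, ha, hb, eval]).mono
      (by simp [Expr.cost, add_assoc]) fun s hs => hs⟩
  | sub e f ihe ihf =>
    obtain ⟨p, hp⟩ := ihe
    obtain ⟨q, hq⟩ := ihf
    exact ⟨p + q + 4, fun n t τ ρ α => (triple_binary (hp n t τ ρ α) (hq n (t + 1) _ ρ α)
      fun s ha hb => by simp only [Expr.eval, ha, hb, eval]).mono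
      (by simp [Expr.cost, add_assoc]) fun s hs => hs⟩
  | sum x e ih =>
    obtain ⟨q, hq⟩ := ih
    refine ⟨.X * (q + 14) + 12, fun n t τ ρ α => ?_⟩
    exact (triple_sum (x := x) (f := fun j => e.eval n α (Function.update ρ x j)) (C := q.eval n)
      fun i _ σ => hq n (t + 3) σ _ α).mono (by simp; nlinarith) fun s hs => hs

lemma Cmd.triple_code (p : Cmd) : ∃ time : Polynomial ℕ, ∀ n t τ ρ α,
    Triple (Represents n t τ ρ α) (p.code t) (time.eval n)
      (Represents n t τ ρ (p.den n ρ α)) := by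
  have restrict {n t t' : ℕ} {τ ρ α} {σ : ℕ → ℕ} {s : State}
      (hs : Represents n (t + t') σ ρ α s) (hσ : ∀ u < t, σ u = τ u) : Represents n t τ ρ α s :=
    hs.mono fun u hu => ⟨by omega, (hσ u hu).symm⟩
  induction p with
  | skip => exact ⟨1, fun n t τ ρ α s hs => ⟨s, 1, .skip s, by simp, hs⟩⟩
  | write a i e =>
    obtain ⟨p, hp⟩ := i.triple_code
    obtain ⟨q, hq⟩ := e.triple_code
    refine ⟨p + (q + 3), fun n t τ ρ α => ((hp n t τ ρ α).seq <| (hq n (t + 1) _ ρ α).seq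
      (C' := 3) fun s hs => ⟨_, _, .write s a _ _, by simp [Expr.cost], ?_⟩).mono (by simp)
      fun s hs => hs⟩
    refine ⟨hs.len, fun u hu => ?_, hs.var, ?_⟩
    · simpa [show u ≠ t by omega, show u ≠ t + 1 by omega] using hs.temp u (by omega)
    · simp [Expr.eval, hs.temp t, hs.temp (t + 1), hs.arr, den, Arrays.set]
  | seq p q ihp ihq =>
    obtain ⟨p', hp⟩ := ihp
    obtain ⟨q', hq⟩ := ihq
    exact ⟨p' + q', fun n t τ ρ α => ((hp n t τ ρ α).seq (hq n t τ ρ _)).mono (by simp)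
      fun s hs => hs⟩
  | ite e p q ihp ihq =>
    obtain ⟨r, hr⟩ := e.triple_code
    obtain ⟨p', hp⟩ := ihp
    obtain ⟨q', hq⟩ := ihq
    refine ⟨r + (2 + p' + q'), fun n t τ ρ α => ((hr n t τ ρ α).seq <| .cond (C := p'.eval n)
      (C' := q'.eval n) (fun s hs => ?_) fun s hs => ?_).mono (by simp [Expr.cost]) fun s hs => hs⟩
    all_goals
      obtain ⟨hs, htest⟩ := hs
      have he : s.reg (treg t) = e.eval n α ρ := by simpa using hs.temp t (by omega)
      have hs' : Represents n t τ ρ α s := restrict hs fun u hu => by simp [hu.ne]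
      simp only [Expr.eval, he] at htest
    · simpa only [den, htest, ne_eq, not_false_eq_true, if_true] using hp n t τ ρ α s hs'
    · simpa only [den, htest, ne_eq, not_true, if_false] using hq n t τ ρ α s hs'
  | loop x p ih =>
    obtain ⟨q, hq⟩ := ih
    exact ⟨.X * (q + 10) + 10, fun n t τ ρ α => (triple_forLoop (fun _ => τ)
      (fun j => iter (fun i α => p.den n (Function.update ρ x i) α) j α)
      fun i _ _ => hq n (t + 2) _ _ _).mono (by simp) fun s hs => hs⟩

end Compilation

/-! ### Logical expressions -/

/-- The array with the adjacency matrix. -/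
abbrev adjArr : ℕ := 0

namespace LExpr

/-- An expression is true if its value is not zero. -/
def IsTrue (n : ℕ) (α : Arrays) (ρ : ℕ → ℕ) (e : LExpr) : Prop := e.eval n α ρ ≠ 0

/-- Negation. -/
def neg (e : LExpr) : LExpr := .sub (.const 1) e

/-- Disjunction. -/
def or (e f : LExpr) : LExpr := .add e f

/-- Conjunction. -/
def and (e f : LExpr) : LExpr := neg (or (neg e) (neg f))

/-- Implication. -/
def imp (e f : LExpr) : LExpr := or (neg e) f

/-- Existential quantification. -/
def ex (x : ℕ) (e : LExpr) : LExpr := .sum x e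

/-- Universal quantification. -/
def all (x : ℕ) (e : LExpr) : LExpr := neg (ex x (neg e))

/-- Equality of values. -/
def eq (e f : LExpr) : LExpr := neg (.add (.sub e f) (.sub f e))

/-- The conjunction of `f 0, …, f (k - 1)`. -/
def conj (f : ℕ → LExpr) : ℕ → LExpr
  | 0 => .const 1
  | k + 1 => and (conj f k) (f k)

/-- Existential quantification over the variables `b, …, b + k - 1`. -/
def exs (e : LExpr) : ℕ → ℕ → LExpr
  | _, 0 => e
  | b, k + 1 => ex b (exs e (b + 1) k)

/-- The entry of the array `a` at the value of the variable `x`. -/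
def mem (a x : ℕ) : LExpr := .read a (.var x)

/-- The adjacency of the vertices in the variables `x` and `y`; the product of `n` and the value
of `x` is a sum over a dummy variable. -/
def adj (x y : ℕ) : LExpr := .read adjArr (.add (.sum (x + 1) (.var x)) (.var y))

variable {n : ℕ} {α : Arrays} {ρ : ℕ → ℕ} {e f : LExpr}

@[simp] lemma isTrue_neg : (neg e).IsTrue n α ρ ↔ ¬ e.IsTrue n α ρ := by
  simp only [IsTrue, neg, eval]; omega

@[simp] lemma isTrue_or : (or e f).IsTrue n α ρ ↔ e.IsTrue n α ρ ∨ f.IsTrue n α ρ := by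
  simp only [IsTrue, or, eval]; omega

@[simp] lemma isTrue_and : (and e f).IsTrue n α ρ ↔ e.IsTrue n α ρ ∧ f.IsTrue n α ρ := by
  simp [and]

@[simp] lemma isTrue_imp : (imp e f).IsTrue n α ρ ↔ (e.IsTrue n α ρ → f.IsTrue n α ρ) := by
  simp [imp, imp_iff_not_or]

@[simp] lemma isTrue_ex {x : ℕ} :
    (ex x e).IsTrue n α ρ ↔ ∃ i : Fin n, e.IsTrue n α (Function.update ρ x i) := by
  simp [IsTrue, ex, eval, Fin.exists_iff]

@[simp] lemma isTrue_all {x : ℕ} :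
    (all x e).IsTrue n α ρ ↔ ∀ i : Fin n, e.IsTrue n α (Function.update ρ x i) := by
  simp [all]

@[simp] lemma isTrue_eq : (eq e f).IsTrue n α ρ ↔ e.eval n α ρ = f.eval n α ρ := by
  simp only [IsTrue, eq, neg, eval]; omega

@[simp] lemma isTrue_mem {a x : ℕ} : (mem a x).IsTrue n α ρ ↔ α a (ρ x) ≠ 0 := Iff.rfl

@[simp] lemma isTrue_adj {x y : ℕ} : (adj x y).IsTrue n α ρ ↔ α adjArr (n * ρ x + ρ y) ≠ 0 := by
  simp [IsTrue, adj, eval]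

lemma isTrue_conj {g : ℕ → LExpr} {k : ℕ} :
    (conj g k).IsTrue n α ρ ↔ ∀ i < k, (g i).IsTrue n α ρ := by
  induction k with
  | zero => simp [conj, IsTrue, eval]
  | succ k ih => rw [conj, isTrue_and, ih, Nat.forall_lt_succ_right]

lemma isTrue_exs {b k : ℕ} : (exs e b k).IsTrue n α ρ ↔
    ∃ σ : ℕ → ℕ, (∀ x, x < b ∨ b + k ≤ x → σ x = ρ x) ∧ (∀ x, b ≤ x → x < b + k → σ x < n) ∧
      e.IsTrue n α σ := by
  induction k generalizing b ρ with
  | zero =>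
    refine ⟨fun h => ⟨ρ, fun _ _ => rfl, fun x _ _ => by omega, h⟩, fun ⟨σ, hσ, _, h⟩ => ?_⟩
    rwa [show σ = ρ from funext fun x => hσ x (by omega)] at h
  | succ k ih =>
    simp only [exs, isTrue_ex, ih]
    constructor
    · rintro ⟨i, σ, hσ, hlt, h⟩
      refine ⟨σ, fun x hx => ?_, fun x hbx hx => ?_, h⟩
      · rw [hσ x (by omega), Function.update_of_ne (by omega)]
      · rcases hbx.eq_or_lt with rfl | hbx
        · simp [hσ b (by omega)]
        · exact hlt x hbx (by omega)
    · rintro ⟨σ, hσ, hlt, h⟩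
      refine ⟨⟨σ b, hlt b le_rfl (by omega)⟩, σ, fun x hx => ?_,
        fun x hbx hx => hlt x (by omega) (by omega), h⟩
      by_cases hxb : x = b
      · simp [hxb]
      · rw [Function.update_of_ne hxb, hσ x (by omega)]

end LExpr

/-! ### Commands -/

/-- The sequence `f` holds the adjacency matrix of `G` row by row. -/
def HasAdj {n : ℕ} (G : SimpleGraph (Fin n)) (f : ℕ → ℕ) : Prop :=
  ∀ i j : Fin n, f (n * i + j) ≠ 0 ↔ G.Adj i j

/-- The set of vertices with nonzero entry in the sequence `f`. -/
def supp (n : ℕ) (f : ℕ → ℕ) : Finset (Fin n) := Finset.univ.filter fun v => f v ≠ 0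

@[simp] lemma mem_supp {n : ℕ} {f : ℕ → ℕ} {v : Fin n} : v ∈ supp n f ↔ f v ≠ 0 := by simp [supp]

lemma iter_induction {S : Type*} {f : ℕ → S → S} {s : S} {n : ℕ} (I : ℕ → S → Prop) (hs : I 0 s)
    (step : ∀ i < n, ∀ s, I i s → I (i + 1) (f i s)) : I n (iter f n s) := by
  induction n with
  | zero => exact hs
  | succ n ih => exact step n n.lt_succ_self _ (ih fun i hi => step i (hi.trans n.lt_succ_self))

/-- The function `f` preserves the invariant `I`, fixes the states satisfying `Q` and decreases the
measure `ν` of all other states. -/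
structure IsReducing {S : Type*} (I : S → Prop) (ν : S → ℕ) (Q : S → Prop) (f : S → S) : Prop where
  invariant : ∀ s, I s → I (f s)
  fixed : ∀ s, I s → Q s → f s = s
  decreasing : ∀ s, I s → ¬ Q s → ν (f s) < ν s

namespace IsReducing

variable {S : Type*} {I Q : S → Prop} {ν : S → ℕ} {n : ℕ} {s : S}

lemma le {f : S → S} (h : IsReducing I ν Q f) (hs : I s) : ν (f s) ≤ ν s := by
  by_cases hQ : Q s
  · rw [h.fixed s hs hQ]
  · exact (h.decreasing s hs hQ).le

lemma iter {f : ℕ → S → S} {Q : ℕ → S → Prop} (h : ∀ i < n, IsReducing I ν (Q i) (f i)) :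
    IsReducing I ν (fun s => ∀ i < n, Q i s) (TreeConvex.iter f n) := by
  induction n with
  | zero => exact ⟨fun _ => id, fun _ _ _ => rfl, fun _ _ hQ => (hQ (by simp)).elim⟩
  | succ n ih =>
    have ih := ih fun i hi => h i (hi.trans n.lt_succ_self)
    have hn := h n n.lt_succ_self
    refine ⟨fun s hs => hn.invariant _ (ih.invariant s hs), fun s hs hQ => ?_, fun s hs hQ => ?_⟩
    · rw [Nat.forall_lt_succ_right] at hQ
      rw [TreeConvex.iter, ih.fixed s hs hQ.1, hn.fixed s hs hQ.2]
    · rw [Nat.forall_lt_succ_right] at hQ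
      by_cases hQn : ∀ i < n, Q i s
      · rw [TreeConvex.iter, ih.fixed s hs hQn]
        exact hn.decreasing s hs fun hQ' => hQ ⟨hQn, hQ'⟩
      · exact (hn.le (ih.invariant s hs)).trans_lt (ih.decreasing s hs hQn)

lemma iter_spec {f : ℕ → S → S} (h : ∀ i, IsReducing I ν Q (f i)) (hs : I s) (hν : ν s ≤ n) :
    I (TreeConvex.iter f n s) ∧ Q (TreeConvex.iter f n s) := by
  obtain ⟨hI, hQ⟩ := iter_induction (f := f) (n := n)
    (fun i s' => I s' ∧ (Q s' ∨ ν s' + i ≤ ν s)) ⟨hs, .inr le_rfl⟩ fun i _ s' ⟨hI, hQ⟩ => by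
      refine ⟨(h i).invariant s' hI, ?_⟩
      by_cases hQ' : Q s'
      · exact .inl (by rwa [(h i).fixed s' hI hQ'])
      · have := (h i).decreasing s' hI hQ'
        exact .inr (by have := hQ.resolve_left hQ'; omega)
  refine ⟨hI, by_contra fun hQ' => ?_⟩
  have := (h 0).decreasing _ hI hQ'
  have := hQ.resolve_left hQ'
  omega

end IsReducing

namespace Cmd

variable {n a : ℕ} {α : Arrays} {ρ : ℕ → ℕ} {p q : Cmd} {e : LExpr}

/-- Whether a command contains an assignment to an entry of the array `a`. -/
def writes (a : ℕ) : Cmd → Bool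
  | .skip => false
  | .write b _ _ => b == a
  | .seq p q => p.writes a || q.writes a
  | .ite _ p q => p.writes a || q.writes a
  | .loop _ p => p.writes a

lemma den_of_not_writes (h : p.writes a = false) : p.den n ρ α a = α a := by
  induction p generalizing ρ α with
  | skip => rfl
  | write b i e => exact Function.update_of_ne (Ne.symm (by simpa [writes] using h)) _ _
  | seq p q ihp ihq =>
    rw [writes, Bool.or_eq_false_iff] at h
    exact (ihq h.2).trans (ihp h.1)
  | ite e p q ihp ihq =>
    rw [writes, Bool.or_eq_false_iff] at h
    rw [den]
    split_ifs
    exacts [ihp h.1, ihq h.2]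
  | loop x p ih =>
    exact iter_induction (fun _ (β : Arrays) => β a = α a) rfl fun i _ β hβ => (ih h).trans hβ

lemma den_ite_of_isTrue (h : e.IsTrue n α ρ) : (ite e p q).den n ρ α = p.den n ρ α := if_pos h

lemma den_ite_of_not_isTrue (h : ¬ e.IsTrue n α ρ) : (ite e p q).den n ρ α = q.den n ρ α :=
  if_neg h

/-- Write the value of `e` for the value `i` of the variable `1` into the entry `i` of the array
`a`, for all `i`. -/
def fill (a : ℕ) (e : LExpr) : Cmd := .loop 1 (.write a (.var 1) e)

lemma den_fill (he : ∀ (β : Arrays) i, (∀ b, b ≠ a → β b = α b) → β a i = α a i →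
      e.eval n β (Function.update ρ 1 i) = e.eval n α (Function.update ρ 1 i)) {i : ℕ}
    (hi : i < n) : (fill a e).den n ρ α a i = e.eval n α (Function.update ρ 1 i) := by
  have H := iter_induction (n := n) (s := α)
    (f := fun i α => (write a (.var 1) e).den n (Function.update ρ 1 i) α)
    (fun k (β : Arrays) => (∀ b, b ≠ a → β b = α b) ∧
      ∀ j, β a j = if j < k then e.eval n α (Function.update ρ 1 j) else α a j)
    ⟨fun _ _ => rfl, fun j => by simp⟩ fun i _ β ⟨hβ, hβa⟩ => by
      refine ⟨fun b hb => by simp [den, Arrays.set, hb, hβ], fun j => ?_⟩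
      rw [den, he β i hβ (by simp [hβa])]
      simp only [Arrays.set, LExpr.eval, Function.update_self, Function.update_apply, hβa]
      grind
  exact (H.2 i).trans (if_pos hi)

lemma supp_den_fill (he : ∀ (β : Arrays) i, (∀ b, b ≠ a → β b = α b) → β a i = α a i →
      e.eval n β (Function.update ρ 1 i) = e.eval n α (Function.update ρ 1 i)) {v : Fin n} :
    v ∈ supp n ((fill a e).den n ρ α a) ↔ e.IsTrue n α (Function.update ρ 1 v) := by
  rw [mem_supp, den_fill he v.2, LExpr.IsTrue]

end Cmd

/-! ### The merging program -/

/-- The array with the parents of the nodes of the forest. -/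
abbrev parArr : ℕ := 2

/-- The array that assigns to the remaining vertices the roots of the forest. -/
abbrev nodeArr : ℕ := 3

/-- The array with the indicator function of the set of remaining vertices. -/
abbrev restArr : ℕ := 4

/-- The array with the indicator function of the side of a bipartition. -/
abbrev sideArr : ℕ := 5

/-- The array with the number of nodes of the forest in its entry `0`. -/
abbrev countArr : ℕ := 9

open LExpr

/-- The test whether the vertex in variable `1` can be merged into the vertex in variable `2`. -/
def canMergeExpr : LExpr :=
  and (mem restArr 1) <| and (mem restArr 2) <| and (neg (eq (.var 1) (.var 2))) <|
    and (imp (mem sideArr 1) (mem sideArr 2)) <|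
    and (imp (mem sideArr 1) (all 3 (imp (mem restArr 3) (imp (adj 1 3) (adj 2 3))))) <|
    imp (neg (mem sideArr 1)) (all 3 (imp (mem restArr 3) (imp (adj 1 3) (eq (.var 3) (.var 2)))))

/-- Merge the vertex in variable `1` into the vertex in variable `2`: their roots become children
of a new root. -/
def mergeCmd : Cmd :=
  .seq (.write parArr (mem nodeArr 1) (.read countArr (.const 0))) <|
  .seq (.write parArr (mem nodeArr 2) (.read countArr (.const 0))) <|
  .seq (.write parArr (.read countArr (.const 0)) (.add .len .len)) <|
  .seq (.write nodeArr (.var 2) (.read countArr (.const 0))) <|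
  .seq (.write countArr (.const 0) (.add (.read countArr (.const 0)) (.const 1))) <|
  .write restArr (.var 1) (.const 0)

/-- Merge vertices as long as possible. -/
def mergeLoop : Cmd := .loop 0 (.loop 1 (.loop 2 (.ite canMergeExpr mergeCmd .skip)))

section

variable {n : ℕ} {G : SimpleGraph (Fin n)} {ρ : ℕ → ℕ} {α : Arrays} {A : Finset (Fin n)}

lemma isTrue_canMergeExpr (hG : HasAdj G (α adjArr)) {u v : Fin n} (hu : ρ 1 = u) (hv : ρ 2 = v) :
    canMergeExpr.IsTrue n α ρ ↔ CanMerge G (supp n (α sideArr)) (supp n (α restArr)) u v := by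
  have adj_iff (x y : Fin n) : ¬ α adjArr (n * x + y) = 0 ↔ G.Adj x y := hG x y
  have canMerge_iff (B R : Finset (Fin n)) : CanMerge G B R u v ↔
      u ∈ R ∧ v ∈ R ∧ u ≠ v ∧ (u ∈ B → v ∈ B) ∧ (u ∈ B → ∀ z ∈ R, G.Adj u z → G.Adj v z) ∧
        (u ∉ B → ∀ z ∈ R, G.Adj u z → z = v) :=
    ⟨fun h => ⟨h.left, h.right, h.ne, h.mem, h.dom, h.pendant⟩,
      fun ⟨h₁, h₂, h₃, h₄, h₅, h₆⟩ => ⟨h₁, h₂, h₃, h₄, h₅, h₆⟩⟩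
  simp [canMergeExpr, canMerge_iff, LExpr.eval, hu, hv, adj_iff, Fin.ext_iff]

lemma supp_den_mergeCmd {u : Fin n} (hu : ρ 1 = u) :
    supp n (mergeCmd.den n ρ α restArr) = (supp n (α restArr)).erase u := by
  have h : mergeCmd.den n ρ α restArr = Function.update (α restArr) (ρ 1) 0 := rfl
  ext w
  by_cases hw : w = u
  · simp [h, hu, hw]
  · simp [h, hu, hw, Function.update_of_ne (Fin.val_ne_of_ne hw)]

/-- The property `I` of the arrays is preserved by all admissible merging steps. -/
def PreservedByMerge (G : SimpleGraph (Fin n)) (A : Finset (Fin n)) (I : Arrays → Prop) : Prop :=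
  ∀ (ρ : ℕ → ℕ) (α : Arrays) (u v : Fin n), ρ 1 = u → ρ 2 = v →
    CanMerge G A (supp n (α restArr)) u v → I α → I (mergeCmd.den n ρ α)

lemma isReducing_merge {I : Arrays → Prop} (hI : PreservedByMerge G A I) {i j : ℕ} (hi : i < n)
    (hj : j < n) :
    IsReducing (fun β => I β ∧ HasAdj G (β adjArr) ∧ supp n (β sideArr) = A)
      (fun β => (supp n (β restArr)).card)
      (fun β => ∀ hi hj, ¬ CanMerge G A (supp n (β restArr)) ⟨i, hi⟩ ⟨j, hj⟩)
      ((Cmd.ite canMergeExpr mergeCmd .skip).den n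
        (Function.update (Function.update ρ 1 i) 2 j)) := by
  set σ := Function.update (Function.update ρ 1 i) 2 j
  set u : Fin n := ⟨i, hi⟩
  set v : Fin n := ⟨j, hj⟩
  have hu : σ 1 = u := rfl
  have hv : σ 2 = v := rfl
  have canMerge_iff (β : Arrays) (hG : HasAdj G (β adjArr)) (hA : supp n (β sideArr) = A) :
      canMergeExpr.IsTrue n β σ ↔ CanMerge G A (supp n (β restArr)) u v := by
    rw [isTrue_canMergeExpr hG hu hv, hA]
  refine ⟨fun β ⟨h, hG, hA⟩ => ?_, fun β ⟨_, hG, hA⟩ hQ => ?_, fun β ⟨_, hG, hA⟩ hQ => ?_⟩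
  · refine ⟨?_, by rwa [Cmd.den_of_not_writes rfl], by rwa [Cmd.den_of_not_writes rfl]⟩
    by_cases huv : CanMerge G A (supp n (β restArr)) u v
    · rw [Cmd.den_ite_of_isTrue ((canMerge_iff β hG hA).2 huv)]
      exact hI σ β u v hu hv huv h
    · rwa [Cmd.den_ite_of_not_isTrue (mt (canMerge_iff β hG hA).1 huv)]
  · exact Cmd.den_ite_of_not_isTrue (mt (canMerge_iff β hG hA).1 (hQ hi hj))
  · simp only [not_forall, not_not] at hQ
    obtain ⟨_, _, hQ⟩ := hQ
    rw [Cmd.den_ite_of_isTrue ((canMerge_iff β hG hA).2 hQ), supp_den_mergeCmd hu]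
    exact Finset.card_erase_lt_of_mem hQ.left

lemma den_mergeLoop {I : Arrays → Prop} (hI : PreservedByMerge G A I)
    (hG : HasAdj G (α adjArr)) (hA : supp n (α sideArr) = A) (h : I α) :
    I (mergeLoop.den n ρ α) ∧
      ∀ u v, ¬ CanMerge G A (supp n (mergeLoop.den n ρ α restArr)) u v := by
  have reducing (k : ℕ) := IsReducing.iter fun i hi => IsReducing.iter fun j hj =>
    isReducing_merge (ρ := Function.update ρ 0 k) hI (i := i) hi (j := j) hj
  obtain ⟨⟨h, -⟩, stuck⟩ := IsReducing.iter_spec reducing ⟨h, hG, hA⟩ (card_finset_fin_le _)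
  exact ⟨h, fun u v => stuck u u.2 v v.2 u.2 v.2⟩

lemma card_supp_den_mergeLoop_le_one_iff {R : Finset (Fin n)} (hG : HasAdj G (α adjArr))
    (hA : supp n (α sideArr) = A) (hR : supp n (α restArr) = R) (hs : IsSide G A R) :
    (supp n (mergeLoop.den n ρ α restArr)).card ≤ 1 ↔ Dismantlable G (R ∩ A) := by
  have preserved : PreservedByMerge G A fun β => MergeInv G A R (supp n (β restArr)) := by
    intro σ β u v hu _ huv h
    rw [supp_den_mergeCmd hu]
    exact h.erase hs huv
  obtain ⟨h, stuck⟩ := den_mergeLoop (ρ := ρ) preserved hG hA (hR ▸ mergeInv_refl)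
  exact (h.dismantlable_iff_card_le_one hs stuck).symm

/-- Set up the forest without edges. -/
def initForest : Cmd :=
  .seq (.write countArr (.const 0) .len) <|
  .seq (Cmd.fill nodeArr (.var 1)) <|
  Cmd.fill parArr (.add .len .len)

/-- Build a forest by merging vertices as long as possible. -/
def buildForest : Cmd := .seq initForest mergeLoop

lemma forestInv_den_initForest {k : ℕ} (hk : 1 ≤ k) :
    ForestInv G k A Finset.univ (initForest.den n ρ α parArr) (initForest.den n ρ α nodeArr)
      (initForest.den n ρ α countArr 0) := by
  have count : initForest.den n ρ α countArr 0 = n := by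
    simp only [initForest, Cmd.den]
    rw [Cmd.den_of_not_writes rfl, Cmd.den_of_not_writes rfl]
    rfl
  have par (v : ℕ) (hv : v < n) : initForest.den n ρ α parArr v = 2 * n := by
    rw [two_mul]
    exact Cmd.den_fill (fun _ _ _ _ => rfl) hv
  have node (v : ℕ) (hv : v < n) : initForest.den n ρ α nodeArr v = v := by
    simp only [initForest, Cmd.den]
    rw [Cmd.den_of_not_writes rfl, Cmd.den_fill (fun _ _ _ _ => rfl) hv]
    rfl
  rw [count]
  exact forestInv_univ hk par node

lemma preservedByMerge_forestInv {k : ℕ} (hk : 1 ≤ k) (hA : IsSide G A Finset.univ)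
    (hw : ∀ v ∈ A, TraceWidthLE G k v) :
    PreservedByMerge G A fun β => (supp n (β restArr)).Nonempty ∧
      MergeInv G A Finset.univ (supp n (β restArr)) ∧
      ForestInv G k A (supp n (β restArr)) (β parArr) (β nodeArr) (β countArr 0) := by
  intro ρ α u v hu hv huv ⟨_, hM, hF⟩
  have hpar : mergeCmd.den n ρ α parArr =
      attach n (α parArr) (α nodeArr (ρ 1)) (α nodeArr (ρ 2)) (α countArr 0) := by
    rw [attach, two_mul]
    rfl
  have hnode : mergeCmd.den n ρ α nodeArr =
    Function.update (α nodeArr) (ρ 2) (α countArr 0) := rfl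
  have hcount : mergeCmd.den n ρ α countArr 0 = α countArr 0 + 1 := rfl
  rw [supp_den_mergeCmd hu, hpar, hnode, hcount, hu, hv]
  exact ⟨⟨v, Finset.mem_erase.2 ⟨huv.ne.symm, huv.right⟩⟩, hM.erase hA huv,
    hF.merge hk hA hw huv⟩

lemma forestInv_den_buildForest {k : ℕ} (hn : 0 < n) (hk : 1 ≤ k) (hG : HasAdj G (α adjArr))
    (hA : IsGoodSide G k A Finset.univ) (hside : supp n (α sideArr) = A)
    (hrest : supp n (α restArr) = Finset.univ) :
    ∃ R : Finset (Fin n), R.card = 1 ∧ ForestInv G k A R (buildForest.den n ρ α parArr)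
      (buildForest.den n ρ α nodeArr) (buildForest.den n ρ α countArr 0) := by
  have rest_eq : supp n (initForest.den n ρ α restArr) = Finset.univ := by
    rwa [Cmd.den_of_not_writes rfl]
  have side_eq : supp n (initForest.den n ρ α sideArr) = A := by
    rwa [Cmd.den_of_not_writes rfl]
  have hG' : HasAdj G (initForest.den n ρ α adjArr) := by rwa [Cmd.den_of_not_writes rfl]
  obtain ⟨⟨hne, hM, hF⟩, stuck⟩ := den_mergeLoop (ρ := ρ)
    (preservedByMerge_forestInv hk hA.toIsSide hA.width) hG' side_eq
    ⟨rest_eq ▸ ⟨⟨0, hn⟩, Finset.mem_univ _⟩, rest_eq ▸ mergeInv_refl,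
      rest_eq ▸ forestInv_den_initForest hk⟩
  refine ⟨_, le_antisymm ?_ hne.card_pos, hF⟩
  rw [← hM.dismantlable_iff_card_le_one hA.toIsSide stuck, Finset.univ_inter]
  exact hA.dismantlable

end

/-! ### Testing a component -/

lemma not_traceWidthLE_iff {V : Type u} {G : SimpleGraph V} {k : ℕ} {r : V} :
    ¬ TraceWidthLE G k r ↔ ∃ f : Fin (k + 1) → V, ∀ i j, i ≠ j →
      ∃ b, G.Adj r b ∧ G.Adj b (f i) ∧ ¬ G.Adj b (f j) := by
  classical
  constructor
  · intro h
    simp only [TraceWidthLE, not_forall, not_le] at h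
    obtain ⟨K, hK, hcard⟩ := h
    obtain ⟨K', hK', hcard'⟩ := Finset.exists_subset_card_eq (s := K) (n := k + 1) hcard
    let e := (K'.equivFinOfCardEq hcard').symm
    exact ⟨fun i => e i, fun i j hij => hK _ (hK' (e i).2) _ (hK' (e j).2) fun he =>
      hij (e.injective (Subtype.ext he))⟩
  · rintro ⟨f, hf⟩ hwidth
    have hinj : Function.Injective f := fun i j hij => by
      by_contra hne
      obtain ⟨b, -, hbi, hbj⟩ := hf i j hne
      exact hbj (hij ▸ hbi)
    have anti : IsTraceAntichain G r (Finset.univ.image f) := by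
      intro x hx y hy hxy
      obtain ⟨i, -, rfl⟩ := Finset.mem_image.1 hx
      obtain ⟨j, -, rfl⟩ := Finset.mem_image.1 hy
      exact hf i j fun hij => hxy (hij ▸ rfl)
    have hcard := hwidth _ anti
    rw [Finset.card_image_of_injective _ hinj, Finset.card_univ, Fintype.card_fin] at hcard
    omega

/-- The array with auxiliary values. -/
abbrev tmpArr : ℕ := 6

/-- The test whether the neighbourhood of the vertex in variable `1` contains a neighbour of the
vertex in variable `x` that is not a neighbour of the vertex in variable `y`. -/
def traceNotLe (x y : ℕ) : LExpr := ex 3 (and (adj 1 3) (and (adj 3 x) (neg (adj 3 y))))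

/-- The test whether the trace width of the vertex in variable `1` exceeds `k`. The members of an
antichain are in the variables `5, …, k + 5`. -/
def wideTrace (k : ℕ) : LExpr :=
  exs (conj (fun i => conj (fun j => if i = j then .const 1 else traceNotLe (5 + i) (5 + j))
    (k + 1)) (k + 1)) 5 (k + 1)

/-- The test whether at most one vertex remains and all trace widths on the side are at
most `k`. -/
def acceptExpr (k : ℕ) : LExpr :=
  and (all 1 (all 2 (imp (mem restArr 1) (imp (mem restArr 2) (eq (.var 1) (.var 2))))))
    (all 1 (imp (mem sideArr 1) (neg (wideTrace k))))

section

variable {n k : ℕ} {G : SimpleGraph (Fin n)} {ρ : ℕ → ℕ} {α : Arrays}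

lemma isTrue_traceNotLe (hG : HasAdj G (α adjArr)) {i j : ℕ} {r x y : Fin n} (hr : ρ 1 = r)
    (hx : ρ (5 + i) = x) (hy : ρ (5 + j) = y) : (traceNotLe (5 + i) (5 + j)).IsTrue n α ρ ↔
      ∃ b, G.Adj r b ∧ G.Adj b x ∧ ¬ G.Adj b y := by
  have hi : 5 + i ≠ 3 := by omega
  have hj : 5 + j ≠ 3 := by omega
  have adj_iff (x y : Fin n) : ¬ α adjArr (n * x + y) = 0 ↔ G.Adj x y := hG x y
  simp [traceNotLe, hi, hj, hr, hx, hy, adj_iff]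

lemma isTrue_wideTrace (hG : HasAdj G (α adjArr)) {r : Fin n} (hr : ρ 1 = r) :
    (wideTrace k).IsTrue n α ρ ↔ ¬ TraceWidthLE G k r := by
  have body_iff (σ : ℕ → ℕ) (hσ : σ 1 = r) (f : Fin (k + 1) → Fin n)
      (hf : ∀ i : Fin (k + 1), σ (5 + i) = f i) :
      (conj (fun i => conj (fun j => if i = j then .const 1 else traceNotLe (5 + i) (5 + j))
        (k + 1)) (k + 1)).IsTrue n α σ ↔
      ∀ i j, i ≠ j → ∃ b, G.Adj r b ∧ G.Adj b (f i) ∧ ¬ G.Adj b (f j) := by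
    simp only [isTrue_conj]
    rw [Fin.forall_iff]
    refine forall₂_congr fun i hi => ?_
    rw [Fin.forall_iff]
    refine forall₂_congr fun j hj => ?_
    split_ifs with hij
    · simp [IsTrue, LExpr.eval, hij]
    · rw [isTrue_traceNotLe hG hσ (hf ⟨i, hi⟩) (hf ⟨j, hj⟩),
        forall_prop_of_true fun h => hij (Fin.ext_iff.1 h)]
  rw [wideTrace, isTrue_exs, not_traceWidthLE_iff]
  constructor
  · rintro ⟨σ, hσ, hlt, h⟩
    exact ⟨fun i => ⟨σ (5 + i), hlt _ (by omega) (by omega)⟩,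
      (body_iff σ ((hσ 1 (by omega)).trans hr) _ fun _ => rfl).1 h⟩
  · rintro ⟨f, hf⟩
    let σ (x : ℕ) : ℕ := if h : 5 ≤ x ∧ x < 5 + (k + 1) then f ⟨x - 5, by omega⟩ else ρ x
    refine ⟨σ, fun x hx => dif_neg (by omega), fun x hx hx' => ?_,
      (body_iff σ hr f fun i => ?_).2 hf⟩
    · simp only [σ, dif_pos (And.intro hx hx'), Fin.is_lt]
    · simp [σ, Nat.le_of_lt_succ i.2]

lemma isTrue_acceptExpr (hG : HasAdj G (α adjArr)) : (acceptExpr k).IsTrue n α ρ ↔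
    (supp n (α restArr)).card ≤ 1 ∧ ∀ r ∈ supp n (α sideArr), TraceWidthLE G k r := by
  rw [acceptExpr, isTrue_and, isTrue_all, isTrue_all]
  refine and_congr ?_ (forall_congr' fun r => ?_)
  · simp only [isTrue_all, isTrue_imp, isTrue_mem, ne_eq, OfNat.one_ne_ofNat, not_false_eq_true,
      Function.update_of_ne, Function.update_self, isTrue_eq, LExpr.eval, ← Fin.ext_iff,
      Finset.card_le_one, mem_supp]
    tauto
  · rw [isTrue_imp, isTrue_neg, isTrue_mem, isTrue_wideTrace hG (Function.update_self ..), mem_supp,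
      not_not, Function.update_self]

/-- The membership of the vertex in variable `1` in the closed neighbourhood of the side. -/
def closedNeighborhoodExpr : LExpr := or (mem sideArr 1) (ex 2 (and (mem sideArr 2) (adj 2 1)))

/-- Add the vertices at distance `2` from the side to the side. -/
def stepSide : Cmd :=
  .seq (Cmd.fill tmpArr <| or (mem sideArr 1) <|
    ex 2 (and (mem sideArr 2) (ex 3 (and (adj 2 3) (adj 3 1))))) <|
  Cmd.fill sideArr (mem tmpArr 1)

/-- Compute the even component of the vertex in variable `4`. -/
def growSide : Cmd :=
  .seq (Cmd.fill sideArr (eq (.var 1) (.var 4))) (.loop 0 stepSide)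

lemma supp_den_fill_mem {a b : ℕ} (hab : b ≠ a) :
    supp n ((Cmd.fill a (mem b 1)).den n ρ α a) = supp n (α b) := by
  ext v
  rw [Cmd.supp_den_fill fun β i hβ _ => by simp [mem, LExpr.eval, hβ b hab], isTrue_mem,
    Function.update_self, mem_supp]

lemma supp_den_stepSide (hG : HasAdj G (α adjArr)) :
    supp n (stepSide.den n ρ α sideArr) = evenStep G (supp n (α sideArr)) := by
  have adj_iff (x y : Fin n) : ¬ α adjArr (n * x + y) = 0 ↔ G.Adj x y := hG x y
  rw [stepSide, Cmd.den, supp_den_fill_mem (by decide)]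
  ext v
  rw [Cmd.supp_den_fill fun β i hβ _ => by
    simp [LExpr.eval, mem, LExpr.or, ex, LExpr.and, neg, adj, hβ]]
  simp [adj_iff, mem_evenStep]

lemma supp_den_growSide (hG : HasAdj G (α adjArr)) {w : Fin n} (hw : ρ 4 = w) :
    supp n (growSide.den n ρ α sideArr) = evenComponent G w := by
  rw [evenComponent, Fintype.card_fin]
  refine (iter_induction (fun i (β : Arrays) => HasAdj G (β adjArr) ∧
    supp n (β sideArr) = (evenStep G)^[i] {w}) ⟨?_, ?_⟩ fun i _ β ⟨hG, hβ⟩ => ⟨?_, ?_⟩).2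
  · rwa [Cmd.den_of_not_writes rfl]
  · ext v
    rw [Cmd.supp_den_fill fun β i _ _ => by simp [LExpr.eval, eq, neg]]
    simp [LExpr.eval, hw, Fin.ext_iff]
  · rwa [Cmd.den_of_not_writes rfl]
  · rw [supp_den_stepSide hG, hβ, Function.iterate_succ_apply']

lemma supp_den_fill_closedNeighborhood {a : ℕ} (hG : HasAdj G (α adjArr)) (ha : a ≠ adjArr)
    (ha' : a ≠ sideArr) : supp n ((Cmd.fill a closedNeighborhoodExpr).den n ρ α a) =
      closedNeighborhood G (supp n (α sideArr)) := by
  have adj_iff (x y : Fin n) : ¬ α adjArr (n * x + y) = 0 ↔ G.Adj x y := hG x y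
  ext v
  rw [Cmd.supp_den_fill fun β i hβ _ => by
    simp [LExpr.eval, closedNeighborhoodExpr, mem, LExpr.or, ex, LExpr.and, neg, adj,
      hβ adjArr ha.symm, hβ sideArr ha'.symm]]
  simp [closedNeighborhoodExpr, adj_iff, mem_closedNeighborhood]

/-- Compute the even component of the vertex in variable `4` and merge the vertices of its closed
neighbourhood. -/
def testSide : Cmd := .seq growSide <| .seq (Cmd.fill restArr closedNeighborhoodExpr) mergeLoop

lemma supp_den_testSide (hG : HasAdj G (α adjArr)) {w : Fin n} (hw : ρ 4 = w) :
    supp n (testSide.den n ρ α sideArr) = evenComponent G w := by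
  rw [testSide, Cmd.den, Cmd.den_of_not_writes rfl, supp_den_growSide hG hw]

lemma isTrue_acceptExpr_testSide {A : Finset (Fin n)} (hG : HasAdj G (α adjArr))
    (hA : IsSide G A Finset.univ) {w : Fin n} (hw : ρ 4 = w) :
    (acceptExpr k).IsTrue n (testSide.den n ρ α) ρ ↔
      IsGoodSide G k (evenComponent G w) (closedNeighborhood G (evenComponent G w)) := by
  have hside := isSide_evenComponent (w := w) hA
  have hsub := evenComponent_subset_closedNeighborhood (G := G) (w := w)
  have hgrow := supp_den_growSide hG hw
  have hG' : HasAdj G (growSide.den n ρ α adjArr) := by rwa [Cmd.den_of_not_writes rfl]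
  rw [isTrue_acceptExpr (by rwa [Cmd.den_of_not_writes rfl]), supp_den_testSide hG hw, testSide,
    Cmd.den, Cmd.den, card_supp_den_mergeLoop_le_one_iff (by rwa [Cmd.den_of_not_writes rfl])
    (by rwa [Cmd.den_of_not_writes rfl])
    (by rw [supp_den_fill_closedNeighborhood hG' (by decide) (by decide), hgrow]) hside,
    Finset.inter_eq_right.2 hsub]
  exact ⟨fun h => ⟨hside, hsub, h.1, h.2⟩, fun h => ⟨h.dismantlable, h.width⟩⟩

end

/-! ### Choosing a side of the graph -/

/-- The array with the indicator function of the side of the components treated so far. -/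
abbrev chosenArr : ℕ := 7

/-- The array with the indicator function of the union of the components treated so far. -/
abbrev doneArr : ℕ := 8

/-- Add the current side to the chosen side. -/
def commitSide : Cmd :=
  .seq (Cmd.fill chosenArr (or (mem chosenArr 1) (mem sideArr 1)))
    (Cmd.fill doneArr (or (mem doneArr 1) closedNeighborhoodExpr))

/-- Test the even component of the vertex in variable `4`, unless its component has been
treated. -/
def tryVertex (k : ℕ) : Cmd :=
  .ite (neg (mem doneArr 4)) (.seq testSide (.ite (acceptExpr k) commitSide .skip)) .skip

/-- Choose a side in every component. -/
def chooseSide (k : ℕ) : Cmd := .loop 4 (tryVertex k)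

/-- The invariant of the choice of a side: the chosen side is good, and all vertices of `A` that
are less than `i` have been treated. -/
structure ChoiceInv {n : ℕ} (G : SimpleGraph (Fin n)) (k : ℕ) (A : Finset (Fin n)) (i : ℕ)
    (α : Arrays) : Prop where
  hasAdj : HasAdj G (α adjArr)
  isGoodSide : IsGoodSide G k (supp n (α chosenArr)) (supp n (α doneArr))
  treated : ∀ v ∈ A, (v : ℕ) < i → v ∈ supp n (α doneArr)

section

variable {n k : ℕ} {G : SimpleGraph (Fin n)} {ρ : ℕ → ℕ} {α : Arrays} {A : Finset (Fin n)}
  {w : Fin n}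

lemma supp_den_commitSide_chosenArr :
    supp n (commitSide.den n ρ α chosenArr) = supp n (α chosenArr) ∪ supp n (α sideArr) := by
  ext v
  rw [commitSide, Cmd.den, Cmd.den_of_not_writes rfl, Cmd.supp_den_fill fun β i hβ hβa => by
    simp [LExpr.eval, LExpr.or, mem, hβ, hβa]]
  simp

lemma supp_den_commitSide_doneArr (hG : HasAdj G (α adjArr)) :
    supp n (commitSide.den n ρ α doneArr) =
      supp n (α doneArr) ∪ closedNeighborhood G (supp n (α sideArr)) := by
  have adj_iff (x y : Fin n) : ¬ α adjArr (n * x + y) = 0 ↔ G.Adj x y := hG x y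
  ext v
  rw [commitSide, Cmd.den, Cmd.supp_den_fill fun β i hβ hβa => by
    simp [LExpr.eval, LExpr.or, LExpr.and, neg, ex, adj, mem, closedNeighborhoodExpr, hβ, hβa]]
  set β := Cmd.den n (Cmd.fill chosenArr (or (mem chosenArr 1) (mem sideArr 1))) ρ α
  have hadj : β adjArr = α adjArr := Cmd.den_of_not_writes rfl
  have hside : β sideArr = α sideArr := Cmd.den_of_not_writes rfl
  have hdone : β doneArr = α doneArr := Cmd.den_of_not_writes rfl
  simp [closedNeighborhoodExpr, hadj, hside, hdone, adj_iff, mem_closedNeighborhood]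

lemma disjoint_closedNeighborhood_evenComponent {D : Finset (Fin n)}
    (hD : ∀ x ∈ D, ∀ y, G.Adj x y → y ∈ D) (hw : w ∉ D) :
    Disjoint D (closedNeighborhood G (evenComponent G w)) := by
  have notMem : ∀ v ∈ evenComponent G w, v ∉ D :=
    evenComponent_induction hw fun x y z hx hxy hyz hz => hx (hD y (hD z hz y hyz.symm) x hxy.symm)
  refine Finset.disjoint_right.2 fun v hv hvD => ?_
  obtain hv | ⟨x, hx, hxv⟩ := mem_closedNeighborhood.1 hv
  · exact notMem v hv hvD
  · exact notMem x hx (hD v hvD x hxv.symm)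

lemma ChoiceInv.commitSide (h : ChoiceInv G k A w α) (hw : w ∉ supp n (α doneArr))
    (hside : supp n (α sideArr) = evenComponent G w)
    (hE : IsGoodSide G k (evenComponent G w) (closedNeighborhood G (evenComponent G w))) :
    ChoiceInv G k A (w + 1) (commitSide.den n ρ α) where
  hasAdj := by
    rw [Cmd.den_of_not_writes rfl]
    exact h.hasAdj
  isGoodSide := by
    rw [supp_den_commitSide_chosenArr, supp_den_commitSide_doneArr h.hasAdj, hside]
    exact h.isGoodSide.union hE (disjoint_closedNeighborhood_evenComponent h.isGoodSide.closed hw)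
  treated v hv hvw := by
    rw [supp_den_commitSide_doneArr h.hasAdj, hside, Finset.mem_union]
    obtain hvw | hvw := Nat.lt_succ_iff_lt_or_eq.1 hvw
    · exact .inl (h.treated v hv hvw)
    · exact .inr (Fin.ext hvw ▸ evenComponent_subset_closedNeighborhood self_mem_evenComponent)

lemma ChoiceInv.succ (h : ChoiceInv G k A w α) (hw : w ∈ A → w ∈ supp n (α doneArr)) :
    ChoiceInv G k A (w + 1) α where
  hasAdj := h.hasAdj
  isGoodSide := h.isGoodSide
  treated v hv hvw := by
    obtain hvw | hvw := Nat.lt_succ_iff_lt_or_eq.1 hvw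
    · exact h.treated v hv hvw
    · obtain rfl := Fin.ext hvw
      exact hw hv

lemma ChoiceInv.tryVertex (hA : IsGoodSide G k A Finset.univ) (h : ChoiceInv G k A w α)
    (hw : ρ 4 = w) : ChoiceInv G k A (w + 1) ((tryVertex k).den n ρ α) := by
  have new_iff : (neg (mem doneArr 4)).IsTrue n α ρ ↔ w ∉ supp n (α doneArr) := by simp [hw]
  by_cases hnew : w ∈ supp n (α doneArr)
  · rw [TreeConvex.tryVertex, Cmd.den_ite_of_not_isTrue (by rwa [new_iff, not_not])]
    exact h.succ fun _ => hnew
  have test : ChoiceInv G k A w (testSide.den n ρ α) := by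
    have hadj : testSide.den n ρ α adjArr = α adjArr := Cmd.den_of_not_writes rfl
    have hchosen : testSide.den n ρ α chosenArr = α chosenArr := Cmd.den_of_not_writes rfl
    have hdone : testSide.den n ρ α doneArr = α doneArr := Cmd.den_of_not_writes rfl
    exact ⟨hadj ▸ h.hasAdj, hchosen ▸ hdone ▸ h.isGoodSide, hdone ▸ h.treated⟩
  have accept_iff := isTrue_acceptExpr_testSide (k := k) h.hasAdj hA.toIsSide hw
  rw [TreeConvex.tryVertex, Cmd.den_ite_of_isTrue (new_iff.2 hnew), Cmd.den]
  by_cases hE : IsGoodSide G k (evenComponent G w) (closedNeighborhood G (evenComponent G w))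
  · rw [Cmd.den_ite_of_isTrue (accept_iff.2 hE)]
    refine test.commitSide ?_ (supp_den_testSide h.hasAdj hw) hE
    rwa [Cmd.den_of_not_writes rfl]
  · rw [Cmd.den_ite_of_not_isTrue (mt accept_iff.1 hE)]
    exact test.succ fun hwA => absurd (hA.evenComponent hwA) hE

lemma isGoodSide_den_chooseSide (hA : IsGoodSide G k A Finset.univ) (hG : HasAdj G (α adjArr))
    (hchosen : supp n (α chosenArr) = ∅) (hdone : supp n (α doneArr) = ∅) :
    IsGoodSide G k (supp n ((chooseSide k).den n ρ α chosenArr)) Finset.univ := by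
  have h : ChoiceInv G k A n ((chooseSide k).den n ρ α) :=
    iter_induction (ChoiceInv G k A) ⟨hG, by rw [hchosen, hdone]; exact isGoodSide_empty, by simp⟩
      fun i hi β hβ => ChoiceInv.tryVertex (w := ⟨i, hi⟩) hA hβ rfl
  exact h.isGoodSide.univ_of_subset hA.toIsSide fun v hv => h.treated v hv v.2

end

/-! ### The program -/

/-- The array with the leaves of the vertices. -/
abbrev leafArr : ℕ := 1

/-- Compute the parent function of a branch decomposition. -/
def decompose (k : ℕ) : Cmd :=
  .seq (chooseSide k) <|
  .seq (Cmd.fill sideArr (mem chosenArr 1)) <|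
  .seq (Cmd.fill restArr (.const 1)) <|
  .seq buildForest <|
  Cmd.fill leafArr (.var 1)

/-- Write the values of `e` for the values `x` and `y` of the variables `1` and `2` into the array
`a` as a matrix, row by row. -/
def Cmd.fillMatrix (a : ℕ) (e : LExpr) : Cmd :=
  .loop 1 <| .loop 2 <| .write a (.add (.sum 3 (.var 1)) (.var 2)) e

/-- Compute the adjacency matrix of the tree from the parent function. -/
def outputTree : Cmd :=
  Cmd.fillMatrix adjArr <| or (eq (mem parArr 1) (.var 2)) (eq (mem parArr 2) (.var 1))

lemma mul_add_inj {n x y x' y' : ℕ} (hy : y < n) (hy' : y' < n) :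
    n * x + y = n * x' + y' ↔ x = x' ∧ y = y' := by
  rw [add_comm, ← and_iff_left (a := y + n * x = n * x' + y') hy,
    ← Nat.div_mod_unique (by omega), Nat.mul_add_div (by omega), Nat.mul_add_mod,
    Nat.div_eq_of_lt hy', Nat.mod_eq_of_lt hy', add_zero, eq_comm, eq_comm (a := y')]

section

variable {n k : ℕ} {G : SimpleGraph (Fin n)} {ρ : ℕ → ℕ} {α : Arrays} {A : Finset (Fin n)}

lemma exists_forestInv_den_decompose (hn : 0 < n) (hk : 1 ≤ k)
    (hA : IsGoodSide G k A Finset.univ) (hG : HasAdj G (α adjArr))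
    (hchosen : supp n (α chosenArr) = ∅) (hdone : supp n (α doneArr) = ∅) :
    ∃ B R : Finset (Fin n), R.card = 1 ∧ ForestInv G k B R ((decompose k).den n ρ α parArr)
      ((decompose k).den n ρ α nodeArr) ((decompose k).den n ρ α countArr 0) := by
  have good := isGoodSide_den_chooseSide (ρ := ρ) hA hG hchosen hdone
  have hG' : HasAdj G ((chooseSide k).den n ρ α adjArr) := by
    rwa [Cmd.den_of_not_writes rfl]
  simp only [decompose, Cmd.den]
  generalize (chooseSide k).den n ρ α = β at good hG' ⊢
  refine ⟨supp n (β chosenArr), ?_⟩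
  rw [Cmd.den_of_not_writes (p := Cmd.fill leafArr _) (a := parArr) rfl,
    Cmd.den_of_not_writes (p := Cmd.fill leafArr _) (a := nodeArr) rfl,
    Cmd.den_of_not_writes (p := Cmd.fill leafArr _) (a := countArr) rfl]
  refine forestInv_den_buildForest hn hk ?_ good ?_ ?_
  · rwa [Cmd.den_of_not_writes rfl, Cmd.den_of_not_writes rfl]
  · rw [Cmd.den_of_not_writes rfl, supp_den_fill_mem (by decide)]
  · ext v
    rw [Cmd.supp_den_fill fun _ _ _ _ => rfl]
    simp [IsTrue, LExpr.eval]

lemma den_decompose_leafArr {v : ℕ} (hv : v < n) : (decompose k).den n ρ α leafArr v = v := by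
  simp only [decompose, Cmd.den]
  rw [Cmd.den_fill (fun _ _ _ _ => rfl) hv]
  exact Function.update_self ..

lemma Cmd.den_fillMatrix {a : ℕ} {e : LExpr} (he : ∀ (β : Arrays) (σ : ℕ → ℕ),
      (∀ b, b ≠ a → β b = α b) → e.eval n β σ = e.eval n α σ) {x y : ℕ} (hx : x < n) (hy : y < n) :
    (fillMatrix a e).den n ρ α a (n * x + y) =
      e.eval n α (Function.update (Function.update ρ 1 x) 2 y) := by
  let value (x y : ℕ) := e.eval n α (Function.update (Function.update ρ 1 x) 2 y)
  let Filled (i j : ℕ) (β : Arrays) : Prop := (∀ b, b ≠ a → β b = α b) ∧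
    ∀ x y, y < n → x < i ∨ x = i ∧ y < j → β a (n * x + y) = value x y
  suffices H : Filled n 0 ((fillMatrix a e).den n ρ α) from H.2 x y hy (.inl hx)
  refine iter_induction (fun i => Filled i 0) ⟨fun _ _ => rfl, fun _ _ _ _ => by omega⟩
    fun i _ β hβ => ?_
  suffices H : Filled i n ((Cmd.loop 2 <| .write a (.add (.sum 3 (.var 1)) (.var 2)) e).den n
      (Function.update ρ 1 i) β) from ⟨H.1, fun x y hy h => H.2 x y hy (by omega)⟩
  refine iter_induction (Filled i) hβ fun j hj γ ⟨hγ, filled⟩ => ?_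
  simp only [Cmd.den, Arrays.set]
  refine ⟨fun b hb => by rw [Function.update_of_ne hb, hγ b hb], fun x y hy h => ?_⟩
  rw [Function.update_self, Function.update_apply, he γ _ hγ]
  have index : (LExpr.add (.sum 3 (.var 1)) (.var 2)).eval n γ
      (Function.update (Function.update ρ 1 i) 2 j) = n * i + j := by
    simp [LExpr.eval]
  simp only [index, mul_add_inj hy hj]
  split_ifs with hxy
  · rw [hxy.1, hxy.2]
  · exact filled x y hy (by omega)

lemma den_outputTree_adjArr {x y : ℕ} (hx : x < n) (hy : y < n) :
    outputTree.den n ρ α adjArr (n * x + y) ≠ 0 ↔ α parArr x = y ∨ α parArr y = x := by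
  rw [outputTree, Cmd.den_fillMatrix (fun β σ hβ => ?_) hx hy]
  · change LExpr.IsTrue .. ↔ _
    simp [LExpr.eval, mem]
  · simp [LExpr.eval, LExpr.or, eq, neg, mem, hβ parArr (by decide)]

end

lemma represents_inputState {n : ℕ} (G : SimpleGraph (Fin n)) :
    Represents n 0 (fun _ => 0) (fun _ => 0) (inputState G).arr (inputState G) :=
  ⟨rfl, fun _ h => absurd h (Nat.not_lt_zero _), fun x => by simp [inputState, vreg], rfl⟩

lemma hasAdj_inputState {n : ℕ} (G : SimpleGraph (Fin n)) :
    HasAdj G ((inputState G).arr adjArr) := by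
  intro i j
  have index (i' j' : Fin n) : n * (i : ℕ) + j = i' * n + j' ↔ i = i' ∧ j = j' := by
    rw [mul_comm (i' : ℕ), mul_add_inj j.2 j'.2, Fin.ext_iff, Fin.ext_iff]
  simp [inputState, index]

/-- Compute a branch decomposition and output its tree. -/
def program (k : ℕ) : Prog :=
  .seq ((decompose k).code 0) <|
  .seq (.assign 0 (.read countArr (.const 0))) <|
  outputTree.code 0

lemma eval_mono (p : Polynomial ℕ) : Monotone fun n => p.eval n := by
  intro a b h
  simp only [Polynomial.eval_eq_sum, Polynomial.sum]
  gcongr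

lemma holds_toBranchDecomposition {n c : ℕ} {s : State} {τ ρ : ℕ → ℕ} {α : Arrays}
    (hp : IsParentMap n c (α parArr)) (hs : Represents c 0 τ ρ (outputTree.den c ρ α) s)
    (hleaf : ∀ v < n, α leafArr v = v) : Holds s hp.toBranchDecomposition where
  size := hs.len
  adj x y := by
    rw [hs.arr, mul_comm]
    exact (den_outputTree_adjArr x.2 y.2).symm
  leaf v := by
    rw [hs.arr, Cmd.den_of_not_writes rfl, hleaf v v.2]
    rfl

theorem computableWithin_isGoodSide {k : ℕ} (hk : 1 ≤ k) :
    ComputableWithin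
      (fun {n} G => 0 < n ∧ ∃ A : Finset (Fin n), IsGoodSide G k A Finset.univ) k := by
  obtain ⟨p, hp⟩ := (decompose k).triple_code
  obtain ⟨q, hq⟩ := outputTree.triple_code
  refine ⟨program k, p + (3 + q.comp (2 * .X)), fun n G ⟨hn, A, hA⟩ => ?_⟩
  obtain ⟨B, R, hR, hforest⟩ := exists_forestInv_den_decompose (ρ := fun _ => 0) hn hk hA
    (hasAdj_inputState G) (by ext; simp [inputState]) (by ext; simp [inputState])
  obtain ⟨hpar, hmimw⟩ := hforest.exists_mimw_le hR
  have hcount := hforest.1.count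
  have hdecompose := hp n 0 (fun _ => 0) (fun _ => 0) (inputState G).arr
  have hleaf v (hv : v < n) :=
    den_decompose_leafArr (k := k) (ρ := fun _ => 0) (α := (inputState G).arr) hv
  set α := (decompose k).den n (fun _ => 0) (inputState G).arr
  set c := α countArr 0
  have hassign : Triple (Represents n 0 (fun _ => 0) (fun _ => 0) α)
      (.assign 0 (.read countArr (.const 0))) 3 (Represents c 0 (fun _ => 0) (fun _ => 0) α) :=
    .assign fun s hs => ⟨by simp [Expr.eval, hs.arr, c], fun _ h => absurd h (Nat.not_lt_zero _),
      fun x => by simpa [vreg] using hs.var x, hs.arr⟩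
  obtain ⟨s, steps, hexec, hsteps, hs⟩ :=
    (hdecompose.seq <| hassign.seq <| hq c 0 _ _ α) _ (represents_inputState G)
  refine ⟨s, steps, hpar.toBranchDecomposition, hexec, hsteps.trans ?_,
    holds_toBranchDecomposition hpar hs hleaf, hmimw⟩
  have hq' : q.eval c ≤ q.eval (2 * n) := eval_mono q (by omega)
  simpa using hq'

lemma ComputableWithin.mono {C C' : ∀ {n : ℕ}, SimpleGraph (Fin n) → Prop} {k k' : ℕ}
    (h : ComputableWithin C k) (hC : ∀ {n} (G : SimpleGraph (Fin n)), C' G → C G)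
    (hk : k ≤ k') : ComputableWithin C' k' :=
  let ⟨p, time, hp⟩ := h
  ⟨p, time, fun n G hG =>
    let ⟨s, steps, D, hexec, hsteps, hs, hD⟩ := hp n G (hC G hG)
    ⟨s, steps, D, hexec, hsteps, hs, hD.trans (by exact_mod_cast hk)⟩⟩

theorem computableWithin_isTreeConvex (t Δ : ℕ) :
    ComputableWithin (fun {_} G => IsTreeConvex t Δ G) (t * Δ + 2) :=
  (computableWithin_isGoodSide (by omega)).mono
    (fun _ hG =>
      let ⟨A, ⟨v, _⟩, hA⟩ := hG.exists_isGoodSide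
      ⟨v.pos, A, hA⟩) le_rfl

/-! ### Transport along bijections -/

section

variable {V : Type u} {W : Type v}

lemma deg_comap (H : SimpleGraph W) (f : V ≃ W) (x : V) : deg (H.comap f) x = deg H (f x) := by
  rw [deg, deg, ← Set.encard_preimage_of_bijective f.bijective]
  rfl

lemma IsBoundedTree.comap {t Δ : ℕ} {H : SimpleGraph W} (hH : IsBoundedTree t Δ H) (f : V ≃ W) :
    IsBoundedTree t Δ (H.comap f) where
  isTree := (SimpleGraph.Iso.comap f H).isTree_iff.2 hH.isTree
  deg_le x := deg_comap H f x ▸ hH.deg_le (f x)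
  branching_le := by
    have : {x | 3 ≤ deg (H.comap f) x} = f ⁻¹' {y | 3 ≤ deg H y} := by
      ext x
      simp only [Set.mem_ofPred_eq, Set.mem_preimage, deg_comap]
    rw [this, Set.encard_preimage_of_bijective f.bijective]
    exact hH.branching_le

lemma IsTreeConvex.comap {t Δ : ℕ} {G : SimpleGraph W} (hG : IsTreeConvex t Δ G) (e : V ≃ W) :
    IsTreeConvex t Δ (G.comap e) := by
  obtain ⟨A, B, hAB, hbip, H, hH, hconn⟩ := hG
  let f : (e ⁻¹' A) ≃ A := e.subtypeEquiv fun _ => Iff.rfl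
  refine ⟨e ⁻¹' A, e ⁻¹' B, by rw [← Set.preimage_union, hAB, Set.preimage_univ],
    ⟨hbip.disjoint.preimage e, fun x y hxy => hbip.mem_of_adj hxy⟩, H.comap f, hH.comap f,
    fun b hb => ?_⟩
  let g : (H.comap f).induce {a : e ⁻¹' A | (G.comap e).Adj b a} ≃g
      H.induce {a : A | G.Adj (e b) a} :=
    { toEquiv := f.subtypeEquiv fun _ => Iff.rfl, map_rel_iff' := Iff.rfl }
  exact g.preconnected_iff.2 (hconn (e b) hb)

lemma cutMim_comap_le (G : SimpleGraph W) (e : V ≃ W) (X : Set W) :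
    cutMim (G.comap e) (e ⁻¹' X) ≤ cutMim G X := by
  refine iSup₂_le fun M hM => ?_
  rw [← (Sym2.map.injective e.injective).encard_image M]
  refine le_iSup₂_of_le (Sym2.map e '' M) ⟨?_, ?_⟩ le_rfl
  · rintro _ ⟨m, hm, rfl⟩
    have := hM.1 hm
    induction m using Sym2.ind
    exact this
  · rintro _ ⟨m, hm, rfl⟩ _ ⟨m', hm', rfl⟩ hne x hx y hy
    obtain ⟨x, hx', rfl⟩ := Sym2.mem_map.1 hx
    obtain ⟨y, hy', rfl⟩ := Sym2.mem_map.1 hy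
    have := hM.2 m hm m' hm' (fun h => hne (by rw [h])) x hx' y hy'
    exact ⟨fun h => this.1 (e.injective h), this.2⟩

/-- The branch decomposition of a set in bijection with `W`. -/
def BranchDecomposition.comap (D : BranchDecomposition W) (e : V ≃ W) : BranchDecomposition V :=
  { D with δ := e.trans D.δ }

lemma BranchDecomposition.mimw_comap_le (D : BranchDecomposition W) (e : V ≃ W)
    (G : SimpleGraph W) : (D.comap e).mimw (G.comap e) ≤ D.mimw G :=
  iSup_mono fun x => iSup_mono fun y => iSup_mono fun _ => cutMim_comap_le G e (D.side x y)

lemma mimWidth_comap_le (G : SimpleGraph W) (e : V ≃ W) :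
    mimWidth (G.comap e) ≤ mimWidth G :=
  le_iInf fun D => (iInf_le _ (D.comap e)).trans (D.mimw_comap_le e G)

end

theorem IsTreeConvex.mimWidth_le {t Δ : ℕ} {V : Type u} [Finite V] {G : SimpleGraph V}
    (hG : IsTreeConvex t Δ G) : mimWidth G ≤ ((t * Δ + 2 : ℕ) : ℕ∞) := by
  let e : V ≃ Fin (Nat.card V) := Finite.equivFin V
  obtain ⟨p, time, hp⟩ := computableWithin_isTreeConvex t Δ
  obtain ⟨-, -, D, -, -, -, hD⟩ := hp _ _ (hG.comap e.symm)
  calc mimWidth G = mimWidth ((G.comap e.symm).comap e) := by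
        rw [SimpleGraph.comap_comap, ← Equiv.coe_trans, Equiv.self_trans_symm]
        rfl
    _ ≤ mimWidth (G.comap e.symm) := mimWidth_comap_le _ e
    _ ≤ D.mimw (G.comap e.symm) := iInf_le _ D
    _ ≤ _ := hD

end TreeConvex

theorem theorem2_general (t Δ : ℕ) :
    (∀ (V : Type*) [Finite V] (G : SimpleGraph V),
      TreeConvex.IsTreeConvex t Δ G → TreeConvex.mimWidth G ≤ ((t * Δ + 2 : ℕ) : ℕ∞)) ∧
    TreeConvex.ComputableWithin
      (fun {n : ℕ} (G : SimpleGraph (Fin n)) => TreeConvex.IsTreeConvex t Δ G) (t * Δ + 2) :=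
  ⟨fun _ _ _ hG => hG.mimWidth_le, TreeConvex.computableWithin_isTreeConvex t Δ⟩

theorem theorem2 (t Δ : ℕ) (ht : 1 ≤ t) (hΔ : 3 ≤ Δ) :
    (∀ (V : Type*) [Finite V] (G : SimpleGraph V),
      TreeConvex.IsTreeConvex t Δ G →
        TreeConvex.mimWidth G ≤ (TreeConvex.mimBound t Δ : ℕ∞)) ∧
    TreeConvex.ComputableWithin
      (fun {n : ℕ} (G : SimpleGraph (Fin n)) => TreeConvex.IsTreeConvex t Δ G)
      (TreeConvex.mimBound t Δ) :=
  have ⟨width, computable⟩ := theorem2_general t Δ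
  ⟨fun V _ G hG => (width V G hG).trans (Nat.cast_le.2 (TreeConvex.le_mimBound hΔ)),
    computable.mono (fun _ hG => hG) (TreeConvex.le_mimBound hΔ)⟩
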